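/- In the two-dimensional geometric knapsack problem with rotations (2DKR) we are given $N\in\mathbb{N}$, the knapsack $[0,N]\times[0,N]$, and a set $I$ of $n$ items, where item $i$ is an open rectangle of width $w_i$ and height $h_i$, with integers $1\le w_i,h_i\le N$. A packing of a subset $I'\subseteq I$ into an axis-parallel rectangle $K$ rotates each item of $I'$ by $0$ or $90$ degrees and translates it, so that the resulting open rectangles are contained in $K$ and pairwise disjoint. A solution of size $k'$ is a set of $k'$ items together with a packing of it into $[0,N]\times[0,N]$; it fits into the restricted knapsack if the packing is into $[0,N]\times[0,(1-1/\tilde k)N]$. Running times count the steps of a uniform-cost random access machine on natural numbers with addition and truncated subtraction (and no multiplication), and $n$ is the number of items. (a) There is an algorithm that, given an instance of 2DKR and integers $k'\ge 0$ and $\tilde k\ge 1$, in time $(\tilde k k')^{O(k')}\cdot n^{O(1)}$ either computes a solution of size $k'$ (the chosen items, their rotations and their positions) or asserts, correctly, that no solution of size $k'$ fits into the restricted knapsack $[0,N]\times[0,(1-1/\tilde k)N]$. (b) There is an algorithm that, given the same input, computes in time $n^{O(1)}$ a set $\bar I\subseteq I$ of $O(\tilde k\,(k')^2)$ items such that, if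 some solution of size $k'$ fits into $[0,N]\times[0,(1-1/\tilde k)N]$, then some $k'$ items of $\bar I$ can be packed into the full knapsack $[0,N]\times[0,N]$. The constants hidden in the $O(\cdot)$ are absolute. Explicitly, there is a constant $C$ such that the time bounds are $C(\tilde k k')^{Ck'}(n+1)^{C}$ and $C(n+1)^{C}$ and the size bound is $C\tilde k(k')^2$, where $0^0=1$. -/

import Mathlib

/-! ### Two-dimensional geometric knapsack with rotations -/

/-- An instance: a square knapsack `[0,N] × [0,N]` and `n` items; item `i` is an open rectangle of
width `w i` and height `h i`. Different items may have equal dimensions. -/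
structure KnapsackInstance where
  N : ℕ
  n : ℕ
  w : Fin n → ℕ
  h : Fin n → ℕ
  w_pos : ∀ i, 0 < w i
  h_pos : ∀ i, 0 < h i
  w_le : ∀ i, w i ≤ N
  h_le : ∀ i, h i ≤ N

namespace KnapsackInstance

/-- The open rectangle occupied by item `i`, rotated by 90 degrees iff `r = true`, when its lower
left corner is moved to `(a, b)`. -/
def placed (I : KnapsackInstance) (i : Fin I.n) (r : Bool) (a b : ℝ) : Set (ℝ × ℝ) :=
  if r then Set.Ioo a (a + I.h i) ×ˢ Set.Ioo b (b + I.w i)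
  else Set.Ioo a (a + I.w i) ×ˢ Set.Ioo b (b + I.h i)

/-- Rotations `rot` and positions `(a i, b i)` pack the items of `S` into `[0,W] × [0,H]`. -/
def IsPacking (I : KnapsackInstance) (W H : ℝ) (S : Finset (Fin I.n))
    (rot : Fin I.n → Bool) (a b : Fin I.n → ℝ) : Prop :=
  (∀ i ∈ S, I.placed i (rot i) (a i) (b i) ⊆ Set.Icc 0 W ×ˢ Set.Icc 0 H) ∧
  ∀ i ∈ S, ∀ j ∈ S, i ≠ j →
    Disjoint (I.placed i (rot i) (a i) (b i)) (I.placed j (rot j) (a j) (b j))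

/-- Some `k` of the items in `S` can be packed into `[0,W] × [0,H]`. -/
def HasSolution (I : KnapsackInstance) (S : Finset (Fin I.n)) (k : ℕ) (W H : ℝ) : Prop :=
  ∃ T ⊆ S, T.card = k ∧ ∃ (rot : Fin I.n → Bool) (a b : Fin I.n → ℝ), I.IsPacking W H T rot a b

end KnapsackInstance

/-! ### Machine model

A uniform-cost random access machine over `ℕ` whose arithmetic is addition and truncated
subtraction (there is no multiplication), programmed in a structured language. Its memory consists
of registers and of arrays with unrestricted natural-number addresses; a (finite) program mentions
finitely many registers and arrays. -/

namespace RAM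

structure State where
  reg : ℕ → ℕ
  arr : ℕ → ℕ → ℕ

inductive Expr where
  | lit (m : ℕ)
  | reg (x : ℕ)
  | read (A : ℕ) (e : Expr)
  | add (e₁ e₂ : Expr)
  | sub (e₁ e₂ : Expr)

def Expr.eval (s : State) : Expr → ℕ
  | .lit m => m
  | .reg x => s.reg x
  | .read A e => s.arr A (e.eval s)
  | .add e₁ e₂ => e₁.eval s + e₂.eval s
  | .sub e₁ e₂ => e₁.eval s - e₂.eval s

/-- Every memory access, constant and arithmetic operation costs one step. -/
def Expr.cost : Expr → ℕ
  | .lit _ => 1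
  | .reg _ => 1
  | .read _ e => e.cost + 1
  | .add e₁ e₂ => e₁.cost + e₂.cost + 1
  | .sub e₁ e₂ => e₁.cost + e₂.cost + 1

inductive Program where
  | skip
  | assign (x : ℕ) (e : Expr)
  | store (A : ℕ) (e₁ e₂ : Expr)
  | seq (p q : Program)
  | branch (e : Expr) (p q : Program)
  | loop (e : Expr) (p : Program)

def State.setReg (s : State) (x v : ℕ) : State :=
  { s with reg := Function.update s.reg x v }

def State.setArr (s : State) (A m v : ℕ) : State :=
  { s with arr := Function.update s.arr A (Function.update (s.arr A) m v) }

/-- `Runs p s t s'`: the program `p`, started in state `s`, halts after exactly `t` steps in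
state `s'`. Tests check whether an expression is nonzero. -/
inductive Runs : Program → State → ℕ → State → Prop
  | skip (s : State) : Runs .skip s 1 s
  | assign (x : ℕ) (e : Expr) (s : State) :
      Runs (.assign x e) s (e.cost + 1) (s.setReg x (e.eval s))
  | store (A : ℕ) (e₁ e₂ : Expr) (s : State) :
      Runs (.store A e₁ e₂) s (e₁.cost + e₂.cost + 1) (s.setArr A (e₁.eval s) (e₂.eval s))
  | seq {p q : Program} {s s' s'' : State} {t t' : ℕ} :
      Runs p s t s' → Runs q s' t' s'' → Runs (.seq p q) s (t + t') s''
  | branch_true {e : Expr} {p q : Program} {s s' : State} {t : ℕ} :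
      e.eval s ≠ 0 → Runs p s t s' → Runs (.branch e p q) s (e.cost + 1 + t) s'
  | branch_false {e : Expr} {p q : Program} {s s' : State} {t : ℕ} :
      e.eval s = 0 → Runs q s t s' → Runs (.branch e p q) s (e.cost + 1 + t) s'
  | loop_exit {e : Expr} {p : Program} {s : State} :
      e.eval s = 0 → Runs (.loop e p) s (e.cost + 1) s
  | loop_step {e : Expr} {p : Program} {s s' s'' : State} {t t' : ℕ} :
      e.eval s ≠ 0 → Runs p s t s' → Runs (.loop e p) s' t' s'' →
        Runs (.loop e p) s (e.cost + 1 + t + t') s''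

end RAM

/-! ### Input and output conventions -/

namespace KnapsackInstance

/-- The input: registers `0, 1, 2, 3` hold `k`, `q`, `N`, `n`, and arrays `0` and `1` hold the
widths and heights of the items; everything else is zero. -/
def input (I : KnapsackInstance) (k q : ℕ) : RAM.State where
  reg x := if x = 0 then k else if x = 1 then q else if x = 2 then I.N
    else if x = 3 then I.n else 0
  arr A m := if hm : m < I.n then
      (if A = 0 then I.w ⟨m, hm⟩ else if A = 1 then I.h ⟨m, hm⟩ else 0)
    else 0

/-- The set of items selected by the output: item `i` is selected iff cell `i` of array `2` is
nonzero. -/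
def outSet (I : KnapsackInstance) (s : RAM.State) : Finset (Fin I.n) :=
  Finset.univ.filter fun i => s.arr 2 i ≠ 0

/-- The output describes a packing of exactly `k` items into the knapsack: array `2` selects the
items, array `3` says which of them are rotated, arrays `4` and `5` hold their positions. -/
def OutputsSolution (I : KnapsackInstance) (k : ℕ) (s : RAM.State) : Prop :=
  (I.outSet s).card = k ∧
  I.IsPacking I.N I.N (I.outSet s) (fun i => decide (s.arr 3 i ≠ 0))
    (fun i => (s.arr 4 i : ℝ)) (fun i => (s.arr 5 i : ℝ))

end KnapsackInstance

/-!
The kernel. Let `M = q k` and `δ = N / M`. A packing of `k` items into the restricted knapsack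
leaves a strip of height `N / q = k δ` empty, so every item can be made higher by `δ`
(`Packs.stretch`); hence all vertical sides can be rounded up to multiples of `δ`, which leaves `M`
height classes. A placed item may now be replaced by a narrower one of the same class, and an
exchange argument (`exists_kernel_choice`) shows that in each orientation and class the `k` narrowest
items suffice. These are `O(q k²)` items. If `n ≤ q` then all items are few enough to be kept, and
otherwise `M ≤ n²`, so that the classes are found in time polynomial in `n` by repeated addition.

The search. It decides exactly whether `k` items of the kernel fit into the full knapsack, by
enumerating combinatorial types of packings. In each of the two directions a packing is described by
labels of the `2 k` sides of its items: the label of a side is the number of items that end at or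
before it (`endsBelow`). Items that are separated in the packing can be recognized by their labels,
and the recursion `IsLines` computes from the labels natural coordinates that are at most the given
real ones and keep the separations (`IsLines.le`, `IsLines.sep`). So `6` digits for each slot (an item
of the kernel, its rotation and four labels), in a base that is `O(q k²)`, encode a packing
(`HasSolution.encodes`), and there are `(q k)^{O(k)}` sequences of digits. Each is tested directly, so
that an answer is correct whatever the digits were.

The programs are verified in a logic of total correctness with step bounds (`RAM.Ends`), in which the
rule for sequential composition supplies the fact that a program changes only what it writes
(`RAM.Frame`).
-/

/-! ### A program logic with step bounds -/

namespace RAM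

@[simp] theorem State.setReg_reg (s : State) (x v y : ℕ) :
    (s.setReg x v).reg y = if y = x then v else s.reg y := by
  simp [State.setReg, Function.update_apply]

@[simp] theorem State.setReg_arr (s : State) (x v : ℕ) : (s.setReg x v).arr = s.arr := rfl

@[simp] theorem State.setArr_reg (s : State) (A m v : ℕ) : (s.setArr A m v).reg = s.reg := rfl

@[simp] theorem State.setArr_arr (s : State) (A m v A' m' : ℕ) :
    (s.setArr A m v).arr A' m' = if A' = A ∧ m' = m then v else s.arr A' m' := by
  by_cases h : A' = A
  · subst h
    simp [State.setArr, Function.update_apply]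
  · simp [State.setArr, h]

/-- `Ends p s T Q`: started in `s`, the program `p` halts within `T` steps in a state
satisfying `Q`. -/
def Ends (p : Program) (s : State) (T : ℕ) (Q : State → Prop) : Prop :=
  ∃ t s', Runs p s t s' ∧ t ≤ T ∧ Q s'

/-- The registers a program may assign. -/
@[simp] def Program.regs : Program → List ℕ
  | .skip => []
  | .assign x _ => [x]
  | .store _ _ _ => []
  | .seq p q => p.regs ++ q.regs
  | .branch _ p q => p.regs ++ q.regs
  | .loop _ p => p.regs

/-- The arrays a program may write to. -/
@[simp] def Program.arrs : Program → List ℕ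
  | .skip => []
  | .assign _ _ => []
  | .store A _ _ => [A]
  | .seq p q => p.arrs ++ q.arrs
  | .branch _ p q => p.arrs ++ q.arrs
  | .loop _ p => p.arrs

/-- `s'` agrees with `s` on everything that `p` does not write. -/
structure Frame (p : Program) (s s' : State) : Prop where
  reg : ∀ x, x ∉ p.regs → s'.reg x = s.reg x
  arr : ∀ A, A ∉ p.arrs → s'.arr A = s.arr A

theorem Frame.refl (p : Program) (s : State) : Frame p s s := ⟨fun _ _ => rfl, fun _ _ => rfl⟩

theorem Frame.trans {p : Program} {s s' s'' : State} (h : Frame p s s') (h' : Frame p s' s'') :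
    Frame p s s'' :=
  ⟨fun x hx => (h'.reg x hx).trans (h.reg x hx), fun A hA => (h'.arr A hA).trans (h.arr A hA)⟩

theorem Frame.mono {p q : Program} {s s' : State} (h : Frame p s s') (hr : p.regs ⊆ q.regs)
    (ha : p.arrs ⊆ q.arrs) : Frame q s s' :=
  ⟨fun x hx => h.reg x fun h' => hx (hr h'), fun A hA => h.arr A fun h' => hA (ha h')⟩

theorem Runs.frame {p : Program} {s s' : State} {t : ℕ} (h : Runs p s t s') : Frame p s s' := by
  induction h with
  | skip s => exact .refl _ _
  | assign x e s =>
    exact ⟨fun y hy => by simp_all [Program.regs], fun A hA => rfl⟩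
  | store A e₁ e₂ s =>
    refine ⟨fun y hy => rfl, fun A' hA => ?_⟩
    have : A' ≠ A := by simpa [Program.arrs] using hA
    funext m
    simp [this]
  | seq _ _ ih₁ ih₂ =>
    exact (ih₁.mono (by simp [Program.regs]) (by simp [Program.arrs])).trans
      (ih₂.mono (by simp [Program.regs]) (by simp [Program.arrs]))
  | branch_true _ _ ih => exact ih.mono (by simp [Program.regs]) (by simp [Program.arrs])
  | branch_false _ _ ih => exact ih.mono (by simp [Program.regs]) (by simp [Program.arrs])
  | loop_exit _ => exact .refl _ _
  | loop_step _ _ _ ih₁ ih₂ =>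
    exact (ih₁.mono (by simp [Program.regs]) (by simp [Program.arrs])).trans ih₂

theorem Ends.mono {p : Program} {s : State} {T T' : ℕ} {Q Q' : State → Prop} (h : Ends p s T Q)
    (hT : T ≤ T') (hQ : ∀ s', Frame p s s' → Q s' → Q' s') : Ends p s T' Q' := by
  obtain ⟨t, s', hr, ht, hq⟩ := h
  exact ⟨t, s', hr, ht.trans hT, hQ s' hr.frame hq⟩

theorem Ends.skip {s : State} {Q : State → Prop} (h : Q s) : Ends .skip s 1 Q :=
  ⟨1, s, .skip s, le_rfl, h⟩

theorem Ends.seq {p q : Program} {s : State} {T₁ T₂ : ℕ} {Q₁ Q : State → Prop}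
    (hp : Ends p s T₁ Q₁) (hq : ∀ s₁, Frame p s s₁ → Q₁ s₁ → Ends q s₁ T₂ Q) :
    Ends (.seq p q) s (T₁ + T₂) Q := by
  obtain ⟨t, s', hr, ht, hq'⟩ := hp
  obtain ⟨t', s'', hr', ht', hq''⟩ := hq s' hr.frame hq'
  exact ⟨t + t', s'', .seq hr hr', by omega, hq''⟩

theorem Ends.branch {e : Expr} {p q : Program} {s : State} {T : ℕ} {Q : State → Prop}
    (hp : e.eval s ≠ 0 → Ends p s T Q) (hq : e.eval s = 0 → Ends q s T Q) :
    Ends (.branch e p q) s (e.cost + 1 + T) Q := by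
  by_cases h : e.eval s = 0
  · obtain ⟨t, s', hr, ht, hq'⟩ := hq h
    exact ⟨_, s', .branch_false h hr, by omega, hq'⟩
  · obtain ⟨t, s', hr, ht, hq'⟩ := hp h
    exact ⟨_, s', .branch_true h hr, by omega, hq'⟩

/-- A loop whose `i`-th iteration starts in a state satisfying `Inv i`, and which is left after at
most `m` iterations. -/
theorem Ends.loop {e : Expr} {p : Program} {T m : ℕ} {Q : State → Prop}
    (Inv : ℕ → State → Prop)
    (hstep : ∀ i s, Inv i s → e.eval s ≠ 0 → i < m ∧ Ends p s T (Inv (i + 1)))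
    (hexit : ∀ i s, Inv i s → e.eval s = 0 → Q s) {s : State} (h0 : Inv 0 s) :
    Ends (.loop e p) s ((m + 1) * (T + e.cost + 1)) Q := by
  suffices H : ∀ d i s, Inv i s → m ≤ i + d →
      Ends (.loop e p) s ((d + 1) * (T + e.cost + 1)) Q from H m 0 s h0 (by omega)
  intro d
  induction d with
  | zero =>
    intro i s hi hd
    by_cases h : e.eval s = 0
    · exact ⟨_, s, .loop_exit h, by omega, hexit i s hi h⟩
    · have := (hstep i s hi h).1
      omega
  | succ d ih =>
    intro i s hi hd
    by_cases h : e.eval s = 0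
    · refine ⟨_, s, .loop_exit h, ?_, hexit i s hi h⟩
      nlinarith [Nat.zero_le ((d + 1) * (T + e.cost + 1))]
    · obtain ⟨_, t, s', hr, ht, hq⟩ := hstep i s hi h
      obtain ⟨t', s'', hr', ht', hq'⟩ := ih (i + 1) s' hq (by omega)
      refine ⟨_, s'', .loop_step h hr hr', ?_, hq'⟩
      have : (d + 1 + 1) * (T + e.cost + 1)
        = (d + 1) * (T + e.cost + 1) + (T + e.cost + 1) := by ring
      omega

/-- `for x := 0, …, e - 1 do p`. -/
def Program.count (x : ℕ) (e : Expr) (p : Program) : Program :=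
  .seq (.assign x (.lit 0))
    (.loop (.sub e (.reg x)) (.seq p (.assign x (.add (.reg x) (.lit 1)))))

@[simp] theorem Program.regs_count (x : ℕ) (e : Expr) (p : Program) :
    (Program.count x e p).regs = x :: (p.regs ++ [x]) := rfl

@[simp] theorem Program.arrs_count (x : ℕ) (e : Expr) (p : Program) :
    (Program.count x e p).arrs = p.arrs := by
  simp [Program.count, Program.arrs]

/-- The rule for counting loops. The bound and the loop variable are not written by the body, and
the states met on the way agree with the initial one on what the loop does not write. -/
theorem Ends.count {x : ℕ} {e : Expr} {p : Program} {s : State} {T m : ℕ} {Q : State → Prop}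
    (Inv : ℕ → State → Prop)
    (he : ∀ s', Frame (Program.count x e p) s s' → e.eval s' = m)
    (hx : x ∉ p.regs)
    (h0 : Inv 0 (s.setReg x 0))
    (hstep : ∀ i s', i < m → Frame (Program.count x e p) s s' → s'.reg x = i → Inv i s' →
      Ends p s' T (fun s'' => Inv (i + 1) (s''.setReg x (i + 1))))
    (hQ : ∀ s', Inv m s' → Q s') :
    Ends (Program.count x e p) s ((m + 1) * (T + e.cost + 9)) Q := by
  have hl : Ends (.loop (.sub e (.reg x)) (.seq p (.assign x (.add (.reg x) (.lit 1)))))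
      (s.setReg x 0) ((m + 1) * (T + 4 + (Expr.sub e (.reg x)).cost + 1)) Q := by
    refine Ends.loop (fun i s' => i ≤ m ∧ Frame (Program.count x e p) s s' ∧ s'.reg x = i ∧ Inv i s')
      ?_ ?_ ?_
    · rintro i s' ⟨him, hf, hi, hinv⟩ hne
      have h1 := he s' hf
      simp only [Expr.eval, h1, hi] at hne
      have hlt : i < m := by omega
      refine ⟨hlt, ?_⟩
      refine Ends.seq (hstep i s' hlt hf hi hinv) fun s₁ hf₁ h₁ => ?_
      have e1 : s₁.reg x = i := (hf₁.reg x hx).trans hi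
      refine ⟨_, _, .assign _ _ _, by simp [Expr.cost], hlt, ?_, ?_, ?_⟩
      · refine hf.trans ((hf₁.mono ?_ ?_).trans ?_)
        · intro y hy
          simp [Program.count, Program.regs, hy]
        · intro y hy
          simp [Program.count, Program.arrs, hy]
        · refine ⟨fun y hy => ?_, fun A _ => rfl⟩
          have : y ≠ x := by
            rintro rfl
            exact hy (by simp [Program.count, Program.regs])
          simp [this]
      · simp [Expr.eval, e1]
      · simpa [Expr.eval, e1] using h₁
    · rintro i s' ⟨him, hf, hi, hinv⟩ hz
      have h1 := he s' hf
      simp only [Expr.eval, h1, hi] at hz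
      have : i = m := by omega
      subst this
      exact hQ s' hinv
    · refine ⟨Nat.zero_le _, ⟨fun y hy => ?_, fun A _ => rfl⟩, by simp, h0⟩
      have : y ≠ x := by
        rintro rfl
        exact hy (by simp [Program.count, Program.regs])
      simp [this]
  have h2 := Ends.seq (T₁ := 2) (Q₁ := fun s' => s' = s.setReg x 0)
    ⟨_, _, .assign x (.lit 0) s, by simp [Expr.cost], by simp [Expr.eval]⟩
    (fun s₁ _ h => h ▸ hl)
  refine h2.mono ?_ fun _ _ h => h
  simp only [Expr.cost]
  nlinarith [Nat.zero_le m]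

/-- Programs without loops. -/
def Program.straight : Program → Bool
  | .skip => true
  | .assign _ _ => true
  | .store _ _ _ => true
  | .seq p q => p.straight && q.straight
  | .branch _ p q => p.straight && q.straight
  | .loop _ _ => false

/-- The effect of a program without loops; loops are ignored. -/
def Program.exec : Program → State → State
  | .skip, s => s
  | .assign x e, s => s.setReg x (e.eval s)
  | .store A e₁ e₂, s => s.setArr A (e₁.eval s) (e₂.eval s)
  | .seq p q, s => q.exec (p.exec s)
  | .branch e p q, s => if e.eval s ≠ 0 then p.exec s else q.exec s
  | .loop _ _, s => s

/-- A bound for the number of steps of a program without loops. -/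
def Program.size : Program → ℕ
  | .skip => 1
  | .assign _ e => e.cost + 1
  | .store _ e₁ e₂ => e₁.cost + e₂.cost + 1
  | .seq p q => p.size + q.size
  | .branch e p q => e.cost + 1 + (p.size + q.size)
  | .loop _ _ => 0

theorem Ends.straight {p : Program} (hp : p.straight = true) {s : State} {Q : State → Prop}
    (hQ : Q (p.exec s)) : Ends p s p.size Q := by
  induction p generalizing s Q with
  | skip => exact Ends.skip hQ
  | assign x e => exact ⟨_, _, .assign _ _ _, le_rfl, hQ⟩
  | store A e₁ e₂ => exact ⟨_, _, .store _ _ _ _, le_rfl, hQ⟩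
  | seq p q ihp ihq =>
    simp only [Program.straight, Bool.and_eq_true] at hp
    refine Ends.seq (Q₁ := fun s' => s' = p.exec s) (ihp hp.1 rfl) ?_
    rintro s₁ - rfl
    exact ihq hp.2 hQ
  | branch e p q ihp ihq =>
    simp only [Program.straight, Bool.and_eq_true] at hp
    refine Ends.branch (T := p.size + q.size) (fun h => ?_) (fun h => ?_)
    · exact (ihp hp.1 (by simpa [Program.exec, h] using hQ)).mono (by omega) fun _ _ h => h
    · exact (ihq hp.2 (by simpa [Program.exec, h] using hQ)).mono (by omega) fun _ _ h => h
  | loop e p => simp [Program.straight] at hp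

end RAM

/-! ### Packings as systems of inequalities -/

/-- The open rectangles of dimensions `w t × h t` with lower left corners `(x t, y t)` lie in
`[0,W] × [0,H]` and are pairwise disjoint. -/
structure Packs {ι : Type*} (W H : ℝ) (w h x y : ι → ℝ) : Prop where
  x_nonneg : ∀ t, 0 ≤ x t
  x_le : ∀ t, x t + w t ≤ W
  y_nonneg : ∀ t, 0 ≤ y t
  y_le : ∀ t, y t + h t ≤ H
  sep : ∀ t u, t ≠ u →
    x t + w t ≤ x u ∨ x u + w u ≤ x t ∨ y t + h t ≤ y u ∨ y u + h u ≤ y t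

theorem Packs.mono {ι : Type*} {W H : ℝ} {w h w' h' x y : ι → ℝ} (hp : Packs W H w h x y)
    (hw : ∀ t, w' t ≤ w t) (hh : ∀ t, h' t ≤ h t) : Packs W H w' h' x y where
  x_nonneg := hp.x_nonneg
  x_le t := by linarith [hp.x_le t, hw t]
  y_nonneg := hp.y_nonneg
  y_le t := by linarith [hp.y_le t, hh t]
  sep t u htu := by
    rcases hp.sep t u htu with h1 | h1 | h1 | h1
    · exact .inl (by linarith [hw t])
    · exact .inr (.inl (by linarith [hw u]))
    · exact .inr (.inr (.inl (by linarith [hh t])))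
    · exact .inr (.inr (.inr (by linarith [hh u])))

/-- The number of rectangles whose upper end is at most `z`. -/
noncomputable def endsBelow {ι : Type*} [Fintype ι] (y h : ι → ℝ) (z : ℝ) : ℕ :=
  (Finset.univ.filter fun u => y u + h u ≤ z).card

theorem endsBelow_mono {ι : Type*} [Fintype ι] (y h : ι → ℝ) {z z' : ℝ} (hz : z ≤ z') :
    endsBelow y h z ≤ endsBelow y h z' := by
  refine Finset.card_le_card fun u hu => ?_
  simp only [Finset.mem_filter, Finset.mem_univ, true_and] at hu ⊢
  linarith

theorem endsBelow_lt {ι : Type*} [Fintype ι] {y h : ι → ℝ} {z : ℝ} {t : ι}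
    (hz : z < y t + h t) : endsBelow y h z < endsBelow y h (y t + h t) := by
  refine Finset.card_lt_card ⟨fun u hu => ?_, fun hs => ?_⟩
  · simp only [Finset.mem_filter, Finset.mem_univ, true_and] at hu ⊢
    linarith
  · have := hs (show t ∈ _ by simp)
    simp only [Finset.mem_filter, Finset.mem_univ, true_and] at this
    linarith

theorem endsBelow_le {ι : Type*} [Fintype ι] (y h : ι → ℝ) (z : ℝ) :
    endsBelow y h z ≤ Fintype.card ι := Finset.card_le_univ _

/-- If there is spare height `δ` for every rectangle, all of them can be made higher by `δ`: move
each one up by `δ` for every rectangle that ends below it. -/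
theorem Packs.stretch {ι : Type*} [Fintype ι] {W H δ : ℝ} {w h h' x y : ι → ℝ}
    (hp : Packs W H w h x y) (hδ : 0 ≤ δ) (hpos : ∀ t, 0 < h t) (hh : ∀ t, h' t ≤ h t + δ) :
    Packs W (H + δ * Fintype.card ι) w h' x (fun t => y t + δ * endsBelow y h (y t)) where
  x_nonneg := hp.x_nonneg
  x_le := hp.x_le
  y_nonneg t := by
    have := hp.y_nonneg t
    positivity
  y_le t := by
    have h1 : endsBelow y h (y t) + 1 ≤ Fintype.card ι :=
      (endsBelow_lt (t := t) (by linarith [hpos t])).trans_le (endsBelow_le _ _ _)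
    have h2 : ((endsBelow y h (y t) : ℝ) + 1) ≤ Fintype.card ι := by exact_mod_cast h1
    nlinarith [hp.y_le t, hh t]
  sep t u htu := by
    have key : ∀ t u, y t + h t ≤ y u →
        y t + δ * endsBelow y h (y t) + h' t ≤ y u + δ * endsBelow y h (y u) := by
      intro t u htu
      have h1 : endsBelow y h (y t) + 1 ≤ endsBelow y h (y u) :=
        (endsBelow_lt (t := t) (by linarith [hpos t])).trans_le (endsBelow_mono _ _ htu)
      have h2 : ((endsBelow y h (y t) : ℝ) + 1) ≤ endsBelow y h (y u) := by exact_mod_cast h1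
      nlinarith [hh t]
    rcases hp.sep t u htu with h1 | h1 | h1 | h1
    · exact .inl h1
    · exact .inr (.inl h1)
    · exact .inr (.inr (.inl (key _ _ h1)))
    · exact .inr (.inr (.inr (key _ _ h1)))

namespace KnapsackInstance

/-- The horizontal side length of item `i`, rotated iff `r`. -/
def hor (I : KnapsackInstance) (i : Fin I.n) (r : Bool) : ℕ := if r then I.h i else I.w i

/-- The vertical side length of item `i`, rotated iff `r`. -/
def ver (I : KnapsackInstance) (i : Fin I.n) (r : Bool) : ℕ := if r then I.w i else I.h i

theorem hor_pos (I : KnapsackInstance) (i : Fin I.n) (r : Bool) : 0 < I.hor i r := by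
  cases r <;> simp [hor, I.w_pos, I.h_pos]

theorem ver_pos (I : KnapsackInstance) (i : Fin I.n) (r : Bool) : 0 < I.ver i r := by
  cases r <;> simp [ver, I.w_pos, I.h_pos]

theorem ver_le (I : KnapsackInstance) (i : Fin I.n) (r : Bool) : I.ver i r ≤ I.N := by
  cases r <;> simp [ver, I.w_le, I.h_le]

theorem placed_eq (I : KnapsackInstance) (i : Fin I.n) (r : Bool) (a b : ℝ) :
    I.placed i r a b = Set.Ioo a (a + I.hor i r) ×ˢ Set.Ioo b (b + I.ver i r) := by
  cases r <;> simp [placed, hor, ver]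

theorem placed_subset_iff (I : KnapsackInstance) (i : Fin I.n) (r : Bool) (a b W H : ℝ) :
    I.placed i r a b ⊆ Set.Icc 0 W ×ˢ Set.Icc 0 H ↔
      0 ≤ a ∧ a + I.hor i r ≤ W ∧ 0 ≤ b ∧ b + I.ver i r ≤ H := by
  have h1 : a < a + I.hor i r := by simpa using I.hor_pos i r
  have h2 : b < b + I.ver i r := by simpa using I.ver_pos i r
  rw [placed_eq, Set.prod_subset_prod_iff]
  simp only [Set.Ioo_eq_empty_iff, h1, h2, not_true_eq_false, or_false]
  have key : ∀ {a c W : ℝ}, a < c → (Set.Ioo a c ⊆ Set.Icc 0 W ↔ 0 ≤ a ∧ c ≤ W) := by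
    intro a c W hac
    constructor
    · intro h
      have := closure_mono h
      rw [closure_Ioo hac.ne, isClosed_Icc.closure_eq] at this
      exact (Set.Icc_subset_Icc_iff hac.le).1 this
    · rintro ⟨h, h'⟩ z ⟨hz, hz'⟩
      exact ⟨by linarith, by linarith⟩
  rw [key h1, key h2]
  tauto

theorem disjoint_placed_iff (I : KnapsackInstance) (i j : Fin I.n) (r r' : Bool)
    (a b a' b' : ℝ) :
    Disjoint (I.placed i r a b) (I.placed j r' a' b') ↔
      a + I.hor i r ≤ a' ∨ a' + I.hor j r' ≤ a ∨ b + I.ver i r ≤ b' ∨ b' + I.ver j r' ≤ b := by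
  have h1 : a < a + I.hor i r := by simpa using I.hor_pos i r
  have h2 : b < b + I.ver i r := by simpa using I.ver_pos i r
  have h3 : a' < a' + I.hor j r' := by simpa using I.hor_pos j r'
  have h4 : b' < b' + I.ver j r' := by simpa using I.ver_pos j r'
  rw [placed_eq, placed_eq, Set.disjoint_prod, Set.Ioo_disjoint_Ioo, Set.Ioo_disjoint_Ioo]
  simp only [min_le_iff, le_max_iff, not_le.2 h1, not_le.2 h2, not_le.2 h3, not_le.2 h4]
  tauto

theorem hasSolution_iff (I : KnapsackInstance) (S : Finset (Fin I.n)) (k : ℕ) (W H : ℝ) :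
    I.HasSolution S k W H ↔ ∃ (f : Fin k → Fin I.n) (r : Fin k → Bool) (x y : Fin k → ℝ),
      Function.Injective f ∧ (∀ t, f t ∈ S) ∧
      Packs W H (fun t => (I.hor (f t) (r t) : ℝ)) (fun t => (I.ver (f t) (r t) : ℝ)) x y := by
  constructor
  · rintro ⟨T, hT, hc, rot, a, b, hin, hdis⟩
    let e := T.equivFinOfCardEq hc
    have hmem : ∀ t, ((e.symm t : T) : Fin I.n) ∈ T := fun t => (e.symm t).2
    refine ⟨fun t => e.symm t, fun t => rot (e.symm t), fun t => a (e.symm t),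
      fun t => b (e.symm t), Subtype.val_injective.comp e.symm.injective,
      fun t => hT (hmem t), ?_⟩
    have hin' := fun t => (I.placed_subset_iff _ _ _ _ _ _).1 (hin _ (hmem t))
    refine ⟨fun t => (hin' t).1, fun t => (hin' t).2.1, fun t => (hin' t).2.2.1,
      fun t => (hin' t).2.2.2, fun t u htu => ?_⟩
    exact (I.disjoint_placed_iff _ _ _ _ _ _ _ _).1 (hdis _ (hmem t) _ (hmem u)
      fun h => htu (e.symm.injective (Subtype.ext h)))
  · rintro ⟨f, r, x, y, hf, hS, hp⟩
    have ext : ∀ {β : Type} [Inhabited β] (g : Fin k → β), ∃ g' : Fin I.n → β,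
        ∀ t, g' (f t) = g t := fun g => ⟨Function.extend f g default, hf.extend_apply g _⟩
    obtain ⟨rot, hrot⟩ := ext r
    obtain ⟨a, ha⟩ := ext x
    obtain ⟨b, hb⟩ := ext y
    refine ⟨Finset.univ.map ⟨f, hf⟩, fun i hi => ?_, by simp, rot, a, b, ?_, ?_⟩
    · obtain ⟨t, -, rfl⟩ := Finset.mem_map.1 hi
      exact hS t
    · intro i hi
      obtain ⟨t, -, rfl⟩ := Finset.mem_map.1 hi
      simp only [Function.Embedding.coeFn_mk, hrot, ha, hb]
      exact (I.placed_subset_iff _ _ _ _ _ _).2 ⟨hp.x_nonneg t, hp.x_le t, hp.y_nonneg t, hp.y_le t⟩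
    · intro i hi j hj hij
      obtain ⟨t, -, rfl⟩ := Finset.mem_map.1 hi
      obtain ⟨u, -, rfl⟩ := Finset.mem_map.1 hj
      simp only [Function.Embedding.coeFn_mk, hrot, ha, hb] at hij ⊢
      exact (I.disjoint_placed_iff _ _ _ _ _ _ _ _).2 (hp.sep t u fun h => hij (h ▸ rfl))

/-! ### The kernel -/

/-- The height class of `v ≤ N`: the least `c` with `v ≤ c * (N / M)`, obtained as the number of
multiples of `N / M` below `v`, which needs no division. -/
def heightClass (N M v : ℕ) : ℕ := ∑ j ∈ Finset.range M, if j * N < v * M then 1 else 0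

theorem heightClass_spec {N M v : ℕ} (hN : 0 < N) (hv : v ≤ N) :
    v * M ≤ heightClass N M v * N ∧ heightClass N M v * N < v * M + N ∧ heightClass N M v ≤ M := by
  -- The sum is `m` as long as all multiples are below `a`, and does not change afterwards.
  have key : ∀ a m, (let c := ∑ j ∈ Finset.range m, if j * N < a then 1 else 0
      c * N < a + N ∧ c ≤ m ∧ (c = m ∨ a ≤ c * N)) := by
    intro a m
    induction m with
    | zero => simp; omega
    | succ m ih =>
      simp only [Finset.sum_range_succ] at ih ⊢
      obtain ⟨h1, h2, h3⟩ := ih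
      set c := ∑ j ∈ Finset.range m, if j * N < a then 1 else 0
      by_cases h : m * N < a
      · rcases h3 with h3 | h3
        · simp only [h, if_true, h3]
          refine ⟨by nlinarith, le_rfl, .inl trivial⟩
        · nlinarith
      · simp only [h, if_false, add_zero]
        refine ⟨h1, by omega, .inr ?_⟩
        rcases h3 with h3 | h3
        · rw [h3]; omega
        · exact h3
  obtain ⟨h1, h2, h3⟩ := key (v * M) M
  refine ⟨?_, h1, h2⟩
  rcases h3 with h3 | h3
  · unfold heightClass
    rw [h3]
    nlinarith
  · exact h3

/-- Among the items placed in orientation `r`, item `j` has the height class of `i` and is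
narrower, ties being broken by the index. -/
def Precedes (I : KnapsackInstance) (M : ℕ) (r : Bool) (j i : Fin I.n) : Prop :=
  heightClass I.N M (I.ver j r) = heightClass I.N M (I.ver i r) ∧
    I.hor j r < I.hor i r + if j < i then 1 else 0

instance (I : KnapsackInstance) (M : ℕ) (r : Bool) (j i : Fin I.n) :
    Decidable (I.Precedes M r j i) := inferInstanceAs (Decidable (_ ∧ _))

/-- The number of items preceding `i`. -/
def rank (I : KnapsackInstance) (M : ℕ) (r : Bool) (i : Fin I.n) : ℕ :=
  ∑ j : Fin I.n, if I.Precedes M r j i then 1 else 0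

/-- In each orientation and for each height class, the `k` narrowest items. -/
def kernel (I : KnapsackInstance) (k q : ℕ) : Finset (Fin I.n) :=
  Finset.univ.filter fun i => ∃ r, I.rank (k * q) r i < k

theorem rank_eq_card (I : KnapsackInstance) (M : ℕ) (r : Bool) (i : Fin I.n) :
    I.rank M r i = (Finset.univ.filter fun j => I.Precedes M r j i).card := by
  simp [rank]

theorem Precedes.trans {I : KnapsackInstance} {M : ℕ} {r : Bool} {i j l : Fin I.n}
    (h : I.Precedes M r i j) (h' : I.Precedes M r j l) : I.Precedes M r i l := by
  refine ⟨h.1.trans h'.1, ?_⟩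
  have h1 := h.2
  have h2 := h'.2
  simp only [Fin.lt_def] at h1 h2 ⊢
  split_ifs at h1 h2 ⊢ <;> omega

theorem not_precedes_self (I : KnapsackInstance) (M : ℕ) (r : Bool) (i : Fin I.n) :
    ¬ I.Precedes M r i i := by simp [Precedes]

theorem rank_lt_rank {I : KnapsackInstance} {M : ℕ} {r : Bool} {i j : Fin I.n}
    (h : I.Precedes M r i j) : I.rank M r i < I.rank M r j := by
  rw [rank_eq_card, rank_eq_card]
  refine Finset.card_lt_card ⟨fun l hl => ?_, fun hs => ?_⟩
  · simp only [Finset.mem_filter, Finset.mem_univ, true_and] at hl ⊢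
    exact hl.trans h
  · have := hs (show i ∈ _ by simpa using h)
    simp only [Finset.mem_filter, Finset.mem_univ, true_and] at this
    exact I.not_precedes_self M r i this

theorem precedes_or_precedes {I : KnapsackInstance} {M : ℕ} {r : Bool} {i j : Fin I.n}
    (h : heightClass I.N M (I.ver i r) = heightClass I.N M (I.ver j r)) (hij : i ≠ j) :
    I.Precedes M r i j ∨ I.Precedes M r j i := by
  simp only [Precedes, h, true_and, Fin.lt_def]
  have : (i : ℕ) ≠ j := fun h => hij (Fin.ext h)
  split_ifs <;> omega

theorem card_kernel_le (I : KnapsackInstance) {k q : ℕ} (hq : 1 ≤ q) :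
    (I.kernel k q).card ≤ 4 * (q * k ^ 2) := by
  rcases Nat.eq_zero_or_pos k with rfl | hk
  · simp [kernel]
  have hcls : ∀ (r : Bool) (c : ℕ), (Finset.univ.filter fun i : Fin I.n =>
      heightClass I.N (k * q) (I.ver i r) = c ∧ I.rank (k * q) r i < k).card ≤ k := by
    intro r c
    refine (Finset.card_le_card_of_injOn (t := Finset.range k) (I.rank (k * q) r) ?_ ?_).trans_eq
      (Finset.card_range k)
    · intro i hi
      simp at hi ⊢
      exact hi.2
    · intro i hi j hj hij
      simp at hi hj
      by_contra hne
      rcases precedes_or_precedes (hi.1.trans hj.1.symm) hne with h | h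
      · exact (rank_lt_rank h).ne hij
      · exact (rank_lt_rank h).ne' hij
  have hsub : I.kernel k q ⊆ (Finset.univ ×ˢ Finset.range (k * q + 1)).biUnion
      fun p : Bool × ℕ => Finset.univ.filter fun i : Fin I.n =>
        heightClass I.N (k * q) (I.ver i p.1) = p.2 ∧ I.rank (k * q) p.1 i < k := by
    intro i hi
    simp only [kernel, Finset.mem_filter, Finset.mem_univ, true_and] at hi
    obtain ⟨r, hr⟩ := hi
    have := (heightClass_spec (M := k * q) ((I.ver_pos i r).trans_le (I.ver_le i r))
      (I.ver_le i r)).2.2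
    simp only [Finset.mem_biUnion, Finset.mem_product, Finset.mem_univ, true_and,
      Finset.mem_range, Finset.mem_filter]
    exact ⟨(r, _), Nat.lt_succ_of_le this, rfl, hr⟩
  refine (Finset.card_le_card hsub).trans (Finset.card_biUnion_le.trans ?_)
  refine (Finset.sum_le_sum fun p _ => hcls p.1 p.2).trans ?_
  simp only [Finset.sum_const, Finset.card_product, Finset.card_univ, Fintype.card_bool,
    Finset.card_range, smul_eq_mul]
  have : 1 ≤ k * q := Nat.mul_pos hk hq
  nlinarith

/-- An injective choice of items can be replaced by one from the kernel that keeps the height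
classes and does not increase the widths: a choice with the least sum of ranks will do, for an item
outside the kernel is preceded by `k` others, one of which is not chosen. -/
theorem exists_kernel_choice (I : KnapsackInstance) {k q : ℕ} (f : Fin k → Fin I.n)
    (r : Fin k → Bool) (hf : Function.Injective f) :
    ∃ g : Fin k → Fin I.n, Function.Injective g ∧ (∀ t, g t ∈ I.kernel k q) ∧
      ∀ t, heightClass I.N (k * q) (I.ver (g t) (r t))
        = heightClass I.N (k * q) (I.ver (f t) (r t)) ∧ I.hor (g t) (r t) ≤ I.hor (f t) (r t) := by
  induction hm : ∑ t, I.rank (k * q) (r t) (f t) using Nat.strong_induction_on generalizing f with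
  | _ m ih =>
  by_cases hall : ∀ t, f t ∈ I.kernel k q
  · exact ⟨f, hf, hall, fun t => ⟨rfl, le_rfl⟩⟩
  push Not at hall
  obtain ⟨t₀, ht₀⟩ := hall
  simp only [kernel, Finset.mem_filter, Finset.mem_univ, true_and, not_exists, not_lt] at ht₀
  have hk := ht₀ (r t₀)
  rw [rank_eq_card] at hk
  obtain ⟨j, hj, hjr⟩ : ∃ j, I.Precedes (k * q) (r t₀) j (f t₀) ∧ ∀ t, f t ≠ j := by
    by_contra hcon
    push Not at hcon
    have hsub : (Finset.univ.filter fun j => I.Precedes (k * q) (r t₀) j (f t₀)) ⊆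
        (Finset.univ.erase t₀).image f := by
      intro j hj
      simp only [Finset.mem_filter, Finset.mem_univ, true_and] at hj
      obtain ⟨t, rfl⟩ := hcon j hj
      refine Finset.mem_image_of_mem _ (Finset.mem_erase.2 ⟨?_, Finset.mem_univ _⟩)
      rintro rfl
      exact I.not_precedes_self _ _ _ hj
    have h1 := (Finset.card_le_card hsub).trans Finset.card_image_le
    rw [Finset.card_erase_of_mem (Finset.mem_univ _), Finset.card_univ, Fintype.card_fin] at h1
    have := t₀.pos
    omega
  have hlt : ∑ t, I.rank (k * q) (r t) (Function.update f t₀ j t) < m := by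
    rw [← hm]
    refine Finset.sum_lt_sum (fun t _ => ?_) ⟨t₀, Finset.mem_univ _, ?_⟩
    · by_cases h : t = t₀
      · subst h
        simpa using (rank_lt_rank hj).le
      · simp [h]
    · simpa using rank_lt_rank hj
  have hinj : Function.Injective (Function.update f t₀ j) := by
    intro t u htu
    by_cases h : t = t₀ <;> by_cases h' : u = t₀ <;> simp [h, h'] at htu ⊢
    · exact (hjr u htu.symm).elim
    · exact (hjr t htu).elim
    · exact hf htu
  obtain ⟨g, hg, hgk, hgf⟩ := ih _ hlt _ hinj rfl
  refine ⟨g, hg, hgk, fun t => ?_⟩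
  have h1 := hgf t
  by_cases h : t = t₀
  · subst h
    simp only [Function.update_self] at h1
    refine ⟨h1.1.trans hj.1, h1.2.trans ?_⟩
    have := hj.2
    split_ifs at this <;> omega
  · simpa [h] using h1

theorem HasSolution.kernel {I : KnapsackInstance} {k q : ℕ} (hk : 1 ≤ k) (hq : 1 ≤ q)
    (h : I.HasSolution Finset.univ k I.N ((1 - 1 / (q : ℝ)) * I.N)) :
    I.HasSolution (I.kernel k q) k I.N I.N := by
  rw [hasSolution_iff] at h ⊢
  obtain ⟨f, r, x, y, hf, -, hp⟩ := h
  obtain ⟨g, hg, hgk, hgf⟩ := I.exists_kernel_choice (q := q) f r hf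
  have hkq : (0 : ℝ) < (k * q : ℕ) := by exact_mod_cast Nat.mul_pos hk hq
  have hq' : (0 : ℝ) < q := by exact_mod_cast hq
  have hk' : (0 : ℝ) < k := by exact_mod_cast hk
  have hspec := fun i r => heightClass_spec (M := k * q) ((I.ver_pos i r).trans_le (I.ver_le i r))
    (I.ver_le i r)
  set δ : ℝ := I.N / (k * q : ℕ) with hδ
  have hs := hp.stretch (δ := δ)
    (h' := fun t => heightClass I.N (k * q) (I.ver (f t) (r t)) * δ)
    (by positivity) (fun t => by exact_mod_cast I.ver_pos _ _) (fun t => by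
      have h1 : (heightClass I.N (k * q) (I.ver (f t) (r t)) * I.N : ℝ)
          ≤ I.ver (f t) (r t) * (k * q : ℕ) + I.N := by
        exact_mod_cast (hspec (f t) (r t)).2.1.le
      rw [hδ, ← sub_nonneg]
      have : (I.ver (f t) (r t) : ℝ) + I.N / (k * q : ℕ)
          - heightClass I.N (k * q) (I.ver (f t) (r t)) * (I.N / (k * q : ℕ))
          = (I.ver (f t) (r t) * (k * q : ℕ) + I.N
            - heightClass I.N (k * q) (I.ver (f t) (r t)) * I.N) / (k * q : ℕ) := by
        field_simp
      rw [this]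
      exact div_nonneg (by linarith) hkq.le)
  have hH : (1 - 1 / (q : ℝ)) * I.N + δ * Fintype.card (Fin k) = I.N := by
    rw [hδ, Fintype.card_fin]
    push_cast
    field_simp
    ring
  rw [hH] at hs
  refine ⟨g, r, x, _, hg, hgk, hs.mono (fun t => ?_) fun t => ?_⟩
  · exact_mod_cast (hgf t).2
  · have h1 : (I.ver (g t) (r t) * (k * q : ℕ) : ℝ)
        ≤ heightClass I.N (k * q) (I.ver (f t) (r t)) * I.N := by
      rw [← (hgf t).1]
      exact_mod_cast (hspec (g t) (r t)).1
    rw [hδ, ← mul_div_assoc, le_div_iff₀ hkq]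
    exact h1

end KnapsackInstance

/-! ### Computing the kernel

Registers `0` to `3` and arrays `0` and `1` hold the input throughout, register `4` the number `k q`
of height classes, and arrays `6` and `7` the height classes of the items placed unrotated and
rotated. The numerical factors in the step bounds are generous. -/

namespace RAM

/-- `1` if `a ≤ b` and `0` otherwise. -/
def Expr.ifLe (a b : Expr) : Expr := .sub (.lit 1) (.sub a b)

/-- `1` if `a < b` and `0` otherwise. -/
def Expr.ifLt (a b : Expr) : Expr := .sub (.lit 1) (.sub (.lit 1) (.sub b a))

/-- `1` if `a = b` and `0` otherwise. -/
def Expr.ifEq (a b : Expr) : Expr := .sub (.lit 1) (.add (.sub a b) (.sub b a))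

@[simp] theorem Expr.eval_ifLe (a b : Expr) (s : State) :
    (a.ifLe b).eval s = if a.eval s ≤ b.eval s then 1 else 0 := by
  simp only [ifLe, eval]; split_ifs <;> omega

@[simp] theorem Expr.eval_ifLt (a b : Expr) (s : State) :
    (a.ifLt b).eval s = if a.eval s < b.eval s then 1 else 0 := by
  simp only [ifLt, eval]; split_ifs <;> omega

@[simp] theorem Expr.eval_ifEq (a b : Expr) (s : State) :
    (a.ifEq b).eval s = if a.eval s = b.eval s then 1 else 0 := by
  simp only [ifEq, eval]; split_ifs <;> omega

/-- Register `4` becomes the product of the registers `0` and `1`. -/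
def Program.mul : Program :=
  .seq (.assign 4 (.lit 0)) (.count 5 (.reg 0) (.assign 4 (.add (.reg 4) (.reg 1))))

theorem ends_mul (s : State) :
    Ends .mul s (20 * (s.reg 0 + 1)) fun s' => s'.reg 4 = s.reg 0 * s.reg 1 := by
  refine (Ends.seq (Ends.straight (p := .assign 4 (.lit 0)) rfl (Q := fun s' => s' = s.setReg 4 0)
    rfl) (fun s₁ _ h => (?_ : Ends _ _ ((s.reg 0 + 1) * (4 + 1 + 9)) _))).mono ?_ fun _ _ h => h
  · subst h
    refine Ends.count (fun i s' => s'.reg 4 = i * s.reg 1) (fun s' hf => ?_) (by decide) (by simp)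
      (fun i s' _ hf hi hinv => ?_) fun s' h => h
    · simpa [Expr.eval] using hf.reg 0 (by decide)
    · refine Ends.straight rfl ?_
      have h1 := hf.reg 1 (by decide)
      simp at h1
      simp [Program.exec, Expr.eval, hinv, h1]
      ring
  · simp only [Program.size, Expr.cost]
    omega

/-- Cell `i` of array `A` becomes the height class of cell `i` of array `V`, for all `i` below the
number of items; register `4` holds the number of classes. -/
def Program.classes (V A : ℕ) : Program :=
  .count 5 (.reg 3)
    (.seq (.seq (.assign 7 (.lit 0)) (.seq (.assign 8 (.lit 0)) (.assign 9 (.lit 0))))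
    (.seq (.count 6 (.reg 4) (.assign 7 (.add (.reg 7) (.read V (.reg 5)))))
    (.seq (.count 6 (.reg 4)
      (.seq (.assign 8 (.add (.reg 8) (.ifLt (.reg 9) (.reg 7))))
        (.assign 9 (.add (.reg 9) (.reg 2)))))
      (.store A (.reg 5) (.reg 8)))))

theorem ends_classes {V A : ℕ} (hVA : V ≠ A) (s : State) :
    Ends (.classes V A) s (100 * ((s.reg 3 + 1) * (s.reg 4 + 1))) fun s' =>
      ∀ i < s.reg 3, s'.arr A i = KnapsackInstance.heightClass (s.reg 2) (s.reg 4) (s.arr V i) := by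
  refine Ends.mono (Ends.count (T := 6 + ((s.reg 4 + 1) * 15 + ((s.reg 4 + 1) * 24 + 3)))
    (fun m s' => ∀ i < m, s'.arr A i =
      KnapsackInstance.heightClass (s.reg 2) (s.reg 4) (s.arr V i)) (fun s' hf => ?_)
      (by simp) (by simp) (fun i s' him hf hi hinv => ?_) fun s' h => h) ?_ fun _ _ h => h
  · simpa [Expr.eval] using hf.reg 3 (by simp)
  · have h2 := hf.reg 2 (by simp)
    have h4 := hf.reg 4 (by simp)
    have hV := hf.arr V (by simp [hVA])
    refine Ends.seq (T₁ := 6) (Q₁ := fun s₁ => s₁.reg 7 = 0 ∧ s₁.reg 8 = 0 ∧ s₁.reg 9 = 0)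
      (Ends.straight rfl (by simp [Program.exec, Expr.eval])) fun s₁ hf₁ ⟨h17, h18, h19⟩ => ?_
    have h15 := (hf₁.reg 5 (by simp)).trans hi
    have h12 := (hf₁.reg 2 (by simp)).trans h2
    have h14 := (hf₁.reg 4 (by simp)).trans h4
    have h1V := (hf₁.arr V (by simp)).trans hV
    have h1A := hf₁.arr A (by simp)
    refine Ends.seq (T₁ := (s.reg 4 + 1) * 15) (Q₁ := fun s₂ => s₂.reg 7 = s.arr V i * s.reg 4)
      ?_ fun s₂ hf₂ h27 => ?_
    · refine Ends.count (T := 5) (fun m s₂ => s₂.reg 7 = s.arr V i * m) (fun s' hf => ?_)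
        (by simp) (by simpa using h17) (fun m s₂ him hf₂ _ h27 => ?_) fun s' h => h
      · simpa [Expr.eval, h14] using hf.reg 4 (by simp)
      · refine Ends.straight (p := .assign 7 _) rfl ?_
        have h5 := hf₂.reg 5 (by simp)
        have hV' := hf₂.arr V (by simp)
        simp [Program.exec, Expr.eval, h27, hV', h5, h15, h1V]
        ring
    have h25 := (hf₂.reg 5 (by simp)).trans h15
    have h22 := (hf₂.reg 2 (by simp)).trans h12
    have h24 := (hf₂.reg 4 (by simp)).trans h14
    have h28 := (hf₂.reg 8 (by simp)).trans h18
    have h29 := (hf₂.reg 9 (by simp)).trans h19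
    have h2A := (hf₂.arr A (by simp)).trans h1A
    refine Ends.seq (T₁ := (s.reg 4 + 1) * 24) (Q₁ := fun s₃ =>
      s₃.reg 8 = KnapsackInstance.heightClass (s.reg 2) (s.reg 4) (s.arr V i))
      ?_ fun s₃ hf₃ h38 => ?_
    · refine Ends.count (T := 14) (fun m s₃ => s₃.reg 9 = m * s.reg 2 ∧ s₃.reg 8 =
        ∑ j ∈ Finset.range m, if j * s.reg 2 < s.arr V i * s.reg 4 then 1 else 0)
        (fun s' hf => ?_) (by simp) (by simp [h29, h28])
        (fun m s₃ him hf₃ _ ⟨h39, h38⟩ => ?_) fun s' h => h.2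
      · simpa [Expr.eval, h24] using hf.reg 4 (by simp)
      · refine (Ends.straight rfl ?_).mono (le_of_eq rfl) fun _ _ h => h
        have h7 := (hf₃.reg 7 (by simp)).trans h27
        have h2 := (hf₃.reg 2 (by simp)).trans h22
        simp [Program.exec, Expr.eval, h38, h39, h7, h2, Finset.sum_range_succ,
          -Finset.sum_boole]
        ring
    have h35 := (hf₃.reg 5 (by simp)).trans h25
    have h3A := (hf₃.arr A (by simp)).trans h2A
    refine Ends.straight (p := .store A _ _) rfl ?_
    intro i' hi'
    rcases Nat.lt_succ_iff_lt_or_eq.1 hi' with h | rfl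
    · simpa [Program.exec, Expr.eval, h35, h.ne, h3A] using hinv i' h
    · simp [Program.exec, Expr.eval, h35, h38]
  · simp only [Expr.cost]
    nlinarith [Nat.zero_le (s.reg 3), Nat.zero_le (s.reg 4)]

/-- The condition by which item `j` precedes item `i`, for the loop variables `i` and `j`, the
classes in array `A` and the widths in array `H`. -/
def Expr.precedes (A H : ℕ) : Expr :=
  -- The conjunction of two conditions with values `0` and `1` is their sum minus one.
  .sub (.add (.ifEq (.read A (.reg 6)) (.read A (.reg 5)))
    (.ifLt (.read H (.reg 6)) (.add (.read H (.reg 5)) (.ifLt (.reg 6) (.reg 5))))) (.lit 1)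

/-- Mark in array `O` the items that fewer than `k` items precede. -/
def Program.select (A H O : ℕ) : Program :=
  .count 5 (.reg 3)
    (.seq (.assign 7 (.lit 0))
    (.seq (.count 6 (.reg 3) (.assign 7 (.add (.reg 7) (.precedes A H))))
      (.branch (.sub (.reg 0) (.reg 7)) (.store O (.reg 5) (.lit 1)) .skip)))

@[simp] theorem Program.regs_select (A H O : ℕ) :
    (Program.select A H O).regs = [5, 7, 6, 7, 6, 5] := rfl

theorem ends_select {A H O : ℕ} (hA : A ≠ O) (hH : H ≠ O) (s : State) :
    Ends (.select A H O) s (100 * ((s.reg 3 + 1) * (s.reg 3 + 1))) fun s' =>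
      ∀ i < s.reg 3, s'.arr O i ≠ 0 ↔ s.arr O i ≠ 0 ∨
        (∑ j ∈ Finset.range (s.reg 3), if s.arr A j = s.arr A i ∧
          s.arr H j < s.arr H i + (if j < i then 1 else 0) then 1 else 0) < s.reg 0 := by
  refine Ends.mono (Ends.count (m := s.reg 3) (T := 2 + ((s.reg 3 + 1) * 50 + 8))
    (fun m s' => ∀ i < s.reg 3, s'.arr O i ≠ 0 ↔ s.arr O i ≠ 0 ∨ i < m ∧
        (∑ j ∈ Finset.range (s.reg 3), if s.arr A j = s.arr A i ∧
          s.arr H j < s.arr H i + (if j < i then 1 else 0) then 1 else 0) < s.reg 0)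
      (fun s' hf => ?_) (by simp) (by simp) (fun i s' him hf hi hinv => ?_) fun s' h i hi => ?_)
      ?_ fun _ _ h => h
  · simpa [Expr.eval] using hf.reg 3 (by simp)
  · have h3 := hf.reg 3 (by simp)
    have h0 := hf.reg 0 (by simp)
    have h1A := hf.arr A (by simp [hA])
    have h1H := hf.arr H (by simp [hH])
    refine Ends.seq (T₁ := 2) (Q₁ := fun s₁ => s₁.reg 7 = 0)
      (Ends.straight rfl (by simp [Program.exec, Expr.eval])) fun s₁ hf₁ h17 => ?_
    have h15 := (hf₁.reg 5 (by simp)).trans hi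
    have h13 := (hf₁.reg 3 (by simp)).trans h3
    have h10 := (hf₁.reg 0 (by simp)).trans h0
    replace h1A := (hf₁.arr A (by simp)).trans h1A
    replace h1H := (hf₁.arr H (by simp)).trans h1H
    have h1O := hf₁.arr O (by simp)
    refine Ends.seq (T₁ := (s.reg 3 + 1) * 50) (Q₁ := fun s₂ => s₂.reg 7 =
      ∑ j ∈ Finset.range (s.reg 3), if s.arr A j = s.arr A i ∧
          s.arr H j < s.arr H i + (if j < i then 1 else 0) then 1 else 0) ?_ fun s₂ hf₂ h27 => ?_
    · refine (Ends.count (fun m s₂ => s₂.reg 7 =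
        ∑ j ∈ Finset.range m, if s.arr A j = s.arr A i ∧
          s.arr H j < s.arr H i + (if j < i then 1 else 0) then 1 else 0) (fun s' hf => ?_)
        (by simp) (by simpa using h17) (fun m s₂ him hf₂ h6 h27 =>
          (Ends.straight rfl ?_)) fun s' h => h).mono
          (Nat.mul_le_mul_left _ (by
            simp [Program.size, Expr.cost, Expr.precedes, Expr.ifEq, Expr.ifLt])) fun _ _ h => h
      · simpa [Expr.eval, h13] using hf.reg 3 (by simp)
      · have h5 := (hf₂.reg 5 (by simp)).trans h15
        have h2A := (hf₂.arr A (by simp)).trans h1A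
        have h2H := (hf₂.arr H (by simp)).trans h1H
        simp only [Program.exec, Expr.eval, Expr.precedes, Expr.eval_ifEq, Expr.eval_ifLt, h27,
          h5, h6, h2A, h2H, Finset.sum_range_succ, State.setReg_reg]
        generalize (∑ j ∈ Finset.range m, _ : ℕ) = c
        by_cases e1 : s.arr A m = s.arr A i <;> simp [e1]
        split_ifs <;> rfl
    have h25 := (hf₂.reg 5 (by simp)).trans h15
    have h20 := (hf₂.reg 0 (by simp)).trans h10
    have h2O := (hf₂.arr O (by simp)).trans h1O
    refine Ends.straight (p := .branch _ (.store O _ _) _) rfl ?_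
    intro i' hi'
    have hi'' := hinv i' hi'
    simp only [Program.exec, Expr.eval, h25, h27, h20]
    obtain ⟨cnt, hcnt⟩ : ∃ cnt : ℕ → ℕ, ∀ i, (∑ j ∈ Finset.range (s.reg 3),
      if s.arr A j = s.arr A i ∧ s.arr H j < s.arr H i + (if j < i then 1 else 0) then 1 else 0)
        = cnt i := ⟨_, fun _ => rfl⟩
    simp only [hcnt, Nat.sub_ne_zero_iff_lt] at hi'' ⊢
    by_cases hii : i' = i
    · subst hii
      rw [← h2O] at hi''
      simp only [lt_irrefl, false_and, or_false] at hi''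
      split_ifs with h
      · simp [h]
      · simp [h, hi'']
    · rw [← h2O] at hi''
      have : i' < i + 1 ↔ i' < i := by omega
      rw [this]
      split_ifs with h
      · simpa [hii] using hi''
      · exact hi''
  · simpa [hi] using h i hi
  · simp only [Expr.cost]
    nlinarith [Nat.zero_le (s.reg 3)]

/-- Mark all items in array `O`. -/
def Program.selectAll (O : ℕ) : Program := .count 5 (.reg 3) (.store O (.reg 5) (.lit 1))

theorem ends_selectAll (O : ℕ) (s : State) :
    Ends (.selectAll O) s (20 * (s.reg 3 + 1)) fun s' => ∀ i < s.reg 3, s'.arr O i ≠ 0 := by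
  refine Ends.mono (Ends.count (T := 3) (fun m s' => ∀ i < m, s'.arr O i ≠ 0) (fun s' hf => ?_)
    (by simp) (by simp) (fun i s' him hf hi hinv => ?_) fun s' h => h) ?_ fun _ _ h => h
  · simpa [Expr.eval] using hf.reg 3 (by simp)
  · refine Ends.straight (p := .store O _ _) rfl fun i' hi' => ?_
    rcases Nat.lt_succ_iff_lt_or_eq.1 hi' with h | rfl
    · simpa [Program.exec, Expr.eval, hi, h.ne] using hinv i' h
    · simp [Program.exec, Expr.eval, hi]
  · simp only [Expr.cost]
    omega

/-- Mark in array `O` a kernel: all items if `n ≤ q`, which keeps the number of height classes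
polynomial in `n`. -/
def Program.kernel (O : ℕ) : Program :=
  .branch (.reg 0)
    (.branch (.ifLe (.reg 0) (.reg 3))
      (.branch (.ifLt (.reg 1) (.reg 3))
        (.seq .mul (.seq (.classes 1 6) (.seq (.classes 0 7)
          (.seq (.select 6 0 O) (.select 7 1 O)))))
        (.selectAll O))
      .skip)
    .skip

end RAM

namespace KnapsackInstance

open RAM

/-- The registers and arrays of the input hold the instance. -/
structure Loaded (I : KnapsackInstance) (k q : ℕ) (s : State) : Prop where
  reg0 : s.reg 0 = k
  reg1 : s.reg 1 = q
  reg2 : s.reg 2 = I.N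
  reg3 : s.reg 3 = I.n
  arr0 : ∀ i : Fin I.n, s.arr 0 i = I.w i
  arr1 : ∀ i : Fin I.n, s.arr 1 i = I.h i

theorem loaded_input (I : KnapsackInstance) (k q : ℕ) : I.Loaded k q (I.input k q) :=
  ⟨rfl, rfl, rfl, rfl, fun i => by simp [input], fun i => by simp [input]⟩

theorem Loaded.frame {I : KnapsackInstance} {k q : ℕ} {s s' : State} {p : Program}
    (h : I.Loaded k q s) (hf : Frame p s s') (hr : ∀ x < 4, x ∉ p.regs)
    (ha : ∀ A < 2, A ∉ p.arrs) : I.Loaded k q s' where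
  reg0 := (hf.reg 0 (hr 0 (by decide))).trans h.reg0
  reg1 := (hf.reg 1 (hr 1 (by decide))).trans h.reg1
  reg2 := (hf.reg 2 (hr 2 (by decide))).trans h.reg2
  reg3 := (hf.reg 3 (hr 3 (by decide))).trans h.reg3
  arr0 i := by rw [hf.arr 0 (ha 0 (by decide))]; exact h.arr0 i
  arr1 i := by rw [hf.arr 1 (ha 1 (by decide))]; exact h.arr1 i

/-- The set marked by the kernel program: empty if no solution has size `k` for trivial reasons, or
if `k = 0`, where the empty set is enough. -/
def kernelSet (I : KnapsackInstance) (k q : ℕ) : Finset (Fin I.n) :=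
  if k = 0 ∨ I.n < k then ∅ else if q < I.n then I.kernel k q else Finset.univ

theorem card_kernelSet_le (I : KnapsackInstance) {k q : ℕ} (hq : 1 ≤ q) :
    (I.kernelSet k q).card ≤ 4 * (q * k ^ 2) := by
  unfold kernelSet
  split_ifs with h1 h2
  · simp
  · exact I.card_kernel_le hq
  · have : 1 ≤ k := by omega
    have : 1 ≤ k ^ 2 := Nat.one_le_pow _ _ this
    simp
    nlinarith

theorem HasSolution.le_n {I : KnapsackInstance} {S : Finset (Fin I.n)} {k : ℕ} {W H : ℝ}
    (h : I.HasSolution S k W H) : k ≤ I.n := by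
  obtain ⟨T, -, rfl, -⟩ := h
  simpa using Finset.card_le_univ T

theorem HasSolution.kernelSet {I : KnapsackInstance} {k q : ℕ} (hq : 1 ≤ q)
    (h : I.HasSolution Finset.univ k I.N ((1 - 1 / (q : ℝ)) * I.N)) :
    I.HasSolution (I.kernelSet k q) k I.N I.N := by
  have hn := h.le_n
  unfold KnapsackInstance.kernelSet
  split_ifs with h1 h2
  · obtain rfl : k = 0 := by omega
    exact ⟨∅, by simp, by simp, fun _ => false, 0, 0, by simp [IsPacking]⟩
  · exact h.kernel (by omega) hq
  · rw [hasSolution_iff] at h ⊢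
    obtain ⟨f, r, x, y, hf, hS, hp⟩ := h
    refine ⟨f, r, x, y, hf, hS, hp.x_nonneg, hp.x_le, hp.y_nonneg, fun t => ?_, hp.sep⟩
    refine (hp.y_le t).trans ?_
    have h1 : (0 : ℝ) ≤ 1 / q * I.N := by positivity
    linarith

theorem ends_kernel (I : KnapsackInstance) {k q O : ℕ} {s : State} (h : I.Loaded k q s)
    (hO : 8 ≤ O ∨ O = 2) (hz : ∀ i, s.arr O i = 0) :
    Ends (.kernel O) s (1000 * (I.n + 1) ^ 3) fun s' =>
      ∀ i : Fin I.n, s'.arr O i ≠ 0 ↔ i ∈ I.kernelSet k q := by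
  have hn : 1 ≤ (I.n + 1) ^ 3 := Nat.one_le_pow _ _ (by omega)
  have hn' : I.n + 1 ≤ (I.n + 1) ^ 3 := Nat.le_self_pow (by norm_num) _
  refine (Ends.branch (T := 900 * (I.n + 1) ^ 3) (fun h0 => (Ends.branch (T := 800 * (I.n + 1) ^ 3)
    (fun h1 => (Ends.branch (T := 700 * (I.n + 1) ^ 3) (fun h2 => ?_) fun h2 => ?_).mono ?_
      fun _ _ h => h) fun h1 => ?_).mono ?_ fun _ _ h => h) fun h0 => ?_).mono ?_ fun _ _ h => h
  all_goals try simp only [Expr.cost, Expr.ifLe, Expr.ifLt]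
  all_goals try omega
  all_goals simp only [Expr.eval, h.reg0, ne_eq] at h0
  all_goals try simp only [Expr.eval, Expr.eval_ifLe, h.reg0, h.reg3, ne_eq,
    ite_eq_right_iff, one_ne_zero, imp_false, not_not] at h1
  all_goals try simp only [Expr.eval, Expr.eval_ifLt, h.reg1, h.reg3, ne_eq,
    ite_eq_right_iff, one_ne_zero, imp_false, not_not] at h2
  · have hset : I.kernelSet k q = I.kernel k q := by
      rw [kernelSet, if_neg (by omega), if_pos h2]
    rw [hset]
    have hM : k * q ≤ I.n * I.n := Nat.mul_le_mul h1 h2.le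
    have hO0 : O ∉ ([6] : List ℕ) ∧ O ∉ ([7] : List ℕ) := by
      constructor <;> (simp only [List.mem_singleton]; omega)
    have b : ∀ p : Program, p.arrs = [O] → ∀ A < 2, A ∉ p.arrs := by
      intro p hp A hA
      rw [hp]
      simp only [List.mem_singleton]
      omega
    refine (Ends.seq ((ends_mul s).mono (T' := 20 * (I.n + 1)) (by rw [h.reg0]; omega)
      fun _ _ h => h) fun s₁ hf₁ h14 => Ends.seq (T₁ := 100 * ((I.n + 1) * (I.n * I.n + 1)))
      (?_ : Ends _ _ _ fun s' => ∀ i : Fin I.n, s'.arr 6 i = heightClass I.N (k * q) (I.ver i false))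
      fun s₂ hf₂ h2A => Ends.seq (T₁ := 100 * ((I.n + 1) * (I.n * I.n + 1)))
      (?_ : Ends _ _ _ fun s' => ∀ i : Fin I.n, s'.arr 7 i = heightClass I.N (k * q) (I.ver i true))
      fun s₃ hf₃ h3A => Ends.seq (T₁ := 100 * ((I.n + 1) * (I.n + 1)))
      (?_ : Ends _ _ _ fun s' => ∀ i : Fin I.n, s'.arr O i ≠ 0 ↔ I.rank (k * q) false i < k)
      fun s₄ hf₄ h4A => (?_ : Ends _ _ (100 * ((I.n + 1) * (I.n + 1))) _)).mono ?_ fun _ _ h => h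
    · have l₁ := h.frame hf₁ (by decide) (by decide)
      rw [h.reg0, h.reg1] at h14
      refine (ends_classes (by decide) s₁).mono ?_ fun s' _ h' i => ?_
      · rw [l₁.reg3, h14]
        gcongr
      · rw [h' i (by rw [l₁.reg3]; exact i.2), h14, l₁.reg2, l₁.arr1]
        rfl
    · have l₁ := h.frame hf₁ (by decide) (by decide)
      have l₂ := l₁.frame hf₂ (by decide) (by decide)
      have h24 := (hf₂.reg 4 (by decide)).trans h14
      rw [h.reg0, h.reg1] at h24
      refine (ends_classes (by decide) s₂).mono ?_ fun s' _ h' i => ?_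
      · rw [l₂.reg3, h24]
        gcongr
      · rw [h' i (by rw [l₂.reg3]; exact i.2), h24, l₂.reg2, l₂.arr0]
        rfl
    · have l₁ := h.frame hf₁ (by decide) (by decide)
      have l₂ := l₁.frame hf₂ (by decide) (by decide)
      have l₃ := l₂.frame hf₃ (by decide) (by decide)
      have hOz : s₃.arr O = s.arr O := (hf₃.arr O hO0.2).trans
        ((hf₂.arr O hO0.1).trans (hf₁.arr O (by exact List.not_mem_nil)))
      have h36 := hf₃.arr 6 (by decide)
      refine (ends_select (by omega) (by omega) s₃).mono ?_ fun s' _ h' i => ?_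
      · rw [l₃.reg3]
      · rw [h' i (by rw [l₃.reg3]; exact i.2), hOz, hz, l₃.reg3, l₃.reg0, Finset.sum_range]
        simp only [h36, h2A, l₃.arr0, ne_eq, not_true_eq_false, false_or]
        rfl
    · have l₁ := h.frame hf₁ (by decide) (by decide)
      have l₂ := l₁.frame hf₂ (by decide) (by decide)
      have l₃ := l₂.frame hf₃ (by decide) (by decide)
      have l₄ := l₃.frame hf₄ (fun x hx => by
        revert x
        rw [Program.regs_select]
        decide) (b _ rfl)
      have h47 := hf₄.arr 7 (by
        change 7 ∉ [O]
        simp only [List.mem_singleton]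
        omega)
      refine (ends_select (by omega) (by omega) s₄).mono ?_ fun s' _ h' i => ?_
      · rw [l₄.reg3]
      · rw [h' i (by rw [l₄.reg3]; exact i.2), h4A i, l₄.reg3, l₄.reg0, Finset.sum_range]
        simp only [h47, h3A, l₄.arr1, kernel, Bool.exists_bool, Finset.mem_filter,
          Finset.mem_univ, true_and]
        rfl
    · nlinarith [Nat.zero_le I.n, Nat.zero_le (I.n ^ 2), Nat.zero_le (I.n ^ 3)]
  · have hset : I.kernelSet k q = Finset.univ := by
      rw [kernelSet, if_neg (by omega), if_neg h2]
    refine (ends_selectAll O s).mono ?_ fun s' _ h' i => ?_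
    · rw [h.reg3]
      omega
    · simpa [hset] using h' i (by rw [h.reg3]; exact i.2)
  · have hset : I.kernelSet k q = ∅ := by rw [kernelSet, if_pos (by omega)]
    refine (Ends.skip (Q := fun s' => ∀ i : Fin I.n, s'.arr O i ≠ 0 ↔ i ∈ I.kernelSet k q)
      fun i => ?_).mono (by omega) fun _ _ h => h
    simp [hset, hz]
  · have hset : I.kernelSet k q = ∅ := by rw [kernelSet, if_pos (by omega)]
    refine (Ends.skip (Q := fun s' => ∀ i : Fin I.n, s'.arr O i ≠ 0 ↔ i ∈ I.kernelSet k q)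
      fun i => ?_).mono (by omega) fun _ _ h => h
    simp [hset, hz]

theorem exists_kernel_program : ∃ (P : Program) (C : ℕ), ∀ (k q : ℕ), 1 ≤ q →
    ∀ I : KnapsackInstance, ∃ (t : ℕ) (s : State), Runs P (I.input k q) t s ∧
      t ≤ C * (I.n + 1) ^ C ∧ (I.outSet s).card ≤ C * (q * k ^ 2) ∧
      (I.HasSolution Finset.univ k (I.N : ℝ) ((1 - 1 / (q : ℝ)) * (I.N : ℝ)) →
        I.HasSolution (I.outSet s) k (I.N : ℝ) (I.N : ℝ)) := by
  refine ⟨.kernel 2, 1000, fun k q hq I => ?_⟩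
  obtain ⟨t, s, hr, ht, hs⟩ := I.ends_kernel (I.loaded_input k q) (O := 2) (.inr rfl)
    (fun i => by simp [input])
  have hset : I.outSet s = I.kernelSet k q := by
    ext i
    simpa [outSet] using hs i
  refine ⟨t, s, hr, ht.trans ?_, ?_, ?_⟩
  · gcongr
    · omega
    · norm_num
  · rw [hset]
    exact (I.card_kernelSet_le hq).trans (by gcongr; norm_num)
  · rw [hset]
    exact fun h => h.kernelSet hq

end KnapsackInstance

/-! ### Encoding packings by digits -/

/-- `G` satisfies the recursion of the line heights: rectangles labelled `(lo t, hi t)` start on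
the line `lo t`, and the line `L` is the lowest one that lies above all rectangles with
`hi t ≤ L`. -/
def IsLines (k : ℕ) (lo hi w G : ℕ → ℕ) : Prop :=
  ∀ L ≤ k, G L = (Finset.range k).sup fun t => if hi t ≤ L then G (lo t) + w t else 0

theorem IsLines.congr {k : ℕ} {lo hi w w' G : ℕ → ℕ} (h : IsLines k lo hi w G)
    (hw : ∀ t < k, w t = w' t) : IsLines k lo hi w' G := fun L hL => by
  rw [h L hL]
  exact Finset.sup_congr rfl fun t ht => by rw [hw t (Finset.mem_range.1 ht)]

/-- Line heights never exceed the coordinates of a packing from which the labels come. -/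
theorem IsLines.le {k : ℕ} {lo hi w G : ℕ → ℕ} (hG : IsLines k lo hi w G) {x : Fin k → ℝ}
    (hw : ∀ t : Fin k, 0 < w t)
    (hlo : ∀ t : Fin k, lo t = endsBelow x (fun u => (w u : ℝ)) (x t))
    (hhi : ∀ t : Fin k, hi t = endsBelow x (fun u => (w u : ℝ)) (x t + w t))
    (hx : ∀ t, 0 ≤ x t) (L : ℕ) (z : ℝ) (hz : 0 ≤ z)
    (hL : L ≤ endsBelow x (fun u => (w u : ℝ)) z) : (G L : ℝ) ≤ z := by
  induction L using Nat.strong_induction_on generalizing z with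
  | _ L ih =>
  have hLk : L ≤ k := hL.trans ((endsBelow_le _ _ _).trans (by simp))
  rw [hG L hLk]
  refine Finset.sup_induction (p := fun a : ℕ => (a : ℝ) ≤ z) (by simpa using hz)
    (fun a ha b hb => by rcases le_total a b with h | h <;> simp [h, ha, hb]) fun t ht => ?_
  rw [Finset.mem_range] at ht
  lift t to Fin k using ht
  split_ifs with h
  · have hwt : (0 : ℝ) < w t := by exact_mod_cast hw t
    have hlt : lo t < hi t := by
      rw [hlo, hhi]
      exact endsBelow_lt (h := fun u : Fin k => (w u : ℝ)) (by linarith)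
    have h1 := ih (lo t) (by omega) (x t) (hx t) (hlo t).le
    have h2 : x t + w t ≤ z := by
      by_contra hcon
      push Not at hcon
      have := endsBelow_lt (y := x) (h := fun u : Fin k => (w u : ℝ)) (t := t) hcon
      rw [← hhi] at this
      omega
    push_cast
    linarith
  · simpa using hz

theorem IsLines.sep {k : ℕ} {lo hi w G : ℕ → ℕ} (hG : IsLines k lo hi w G) {x : Fin k → ℝ}
    (hlo : ∀ t : Fin k, lo t = endsBelow x (fun u => (w u : ℝ)) (x t))
    (hhi : ∀ t : Fin k, hi t = endsBelow x (fun u => (w u : ℝ)) (x t + w t))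
    {t u : Fin k} (h : x t + w t ≤ x u) : G (lo t) + w t ≤ G (lo u) := by
  have h1 : hi t ≤ lo u := by
    rw [hhi, hlo]
    exact endsBelow_mono _ _ h
  have h2 : lo u ≤ k := by
    rw [hlo]
    exact (endsBelow_le _ _ _).trans (by simp)
  rw [hG _ h2]
  refine le_trans ?_ (Finset.le_sup (f := fun t => if hi t ≤ lo u then G (lo t) + w t else 0)
    (Finset.mem_range.2 t.2))
  simp [h1]

theorem exists_digits {B : ℕ} (K : ℕ) (D : ℕ → ℕ) (hD : ∀ p < K, D p < B) :
    ∃ i < B ^ K, ∀ p < K, i / B ^ p % B = D p := by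
  induction K generalizing D with
  | zero => exact ⟨0, by simp, by simp⟩
  | succ K ih =>
    obtain ⟨i, hi, hp⟩ := ih (fun p => D (p + 1)) fun p hp => hD _ (by omega)
    have h0 := hD 0 (by omega)
    have hB : 0 < B := by omega
    refine ⟨D 0 + B * i, ?_, fun p hp' => ?_⟩
    · rw [pow_succ]
      nlinarith
    · cases p with
      | zero => simp [Nat.mod_eq_of_lt h0]
      | succ p =>
        rw [pow_succ', ← Nat.div_div_eq_div_mul, Nat.add_mul_div_left _ _ hB,
          Nat.div_eq_of_lt h0, zero_add]
        exact hp p (by omega)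

/-- Adding one to a number: the digit at `p` changes iff all lower digits of `i + 1` vanish. -/
theorem digit_succ {B : ℕ} (hB : 0 < B) (i p : ℕ) :
    let c := if B ^ p ∣ i + 1 then 1 else 0
    (i / B ^ p % B + c = B → (i + 1) / B ^ p % B = 0 ∧ B ^ (p + 1) ∣ i + 1) ∧
      (i / B ^ p % B + c ≠ B →
        (i + 1) / B ^ p % B = i / B ^ p % B + c ∧ ¬ B ^ (p + 1) ∣ i + 1) := by
  intro c
  have hc : (i + 1) / B ^ p = i / B ^ p + c := Nat.succ_div
  have hlt := Nat.mod_lt (i / B ^ p) hB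
  have hdvd : B ^ (p + 1) ∣ i + 1 ↔ B ^ p ∣ i + 1 ∧ B ∣ (i + 1) / B ^ p := by
    constructor
    · intro h
      exact ⟨(pow_dvd_pow B (Nat.le_succ p)).trans h,
        (Nat.dvd_div_iff_mul_dvd ((pow_dvd_pow B (Nat.le_succ p)).trans h)).2 (by
          rwa [← pow_succ])⟩
    · rintro ⟨h, h'⟩
      rw [pow_succ]
      exact (Nat.dvd_div_iff_mul_dvd h).1 h'
  have hmod : (i / B ^ p + c) % B = (i / B ^ p % B + c) % B := by simp [Nat.add_mod]
  have hc1 : c ≤ 1 := by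
    simp only [c]
    split_ifs <;> omega
  rw [hdvd, hc, hmod]
  constructor
  · intro h
    have : c ≠ 0 := by omega
    refine ⟨by rw [h, Nat.mod_self], by simpa [c] using this, ?_⟩
    rw [Nat.dvd_iff_mod_eq_zero, hmod, h, Nat.mod_self]
  · intro h
    have h1 : (i / B ^ p % B + c) % B = i / B ^ p % B + c := Nat.mod_eq_of_lt (by omega)
    refine ⟨h1, ?_⟩
    rintro ⟨h2, h3⟩
    have h4 : c = 1 := by simp [c, h2]
    rw [Nat.dvd_iff_mod_eq_zero, hmod, h1] at h3
    omega

namespace KnapsackInstance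

variable {I : KnapsackInstance}

/-- The width of slot `t`: the digit `t` names an item of the list `L`, and the digit `t + k` says
whether it is rotated. -/
def slotW (L : ℕ → Fin I.n) (k : ℕ) (D : ℕ → ℕ) (t : ℕ) : ℕ :=
  I.hor (L (D t)) (decide (D (t + k) ≠ 0))

/-- The height of slot `t`. -/
def slotH (L : ℕ → Fin I.n) (k : ℕ) (D : ℕ → ℕ) (t : ℕ) : ℕ :=
  I.ver (L (D t)) (decide (D (t + k) ≠ 0))

/-- The digits describe a packing of the items in the slots into the knapsack: digits `t + 2 k`
to `t + 5 k` are the labels of the left, right, lower and upper side of slot `t`. -/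
def Encodes (L : ℕ → Fin I.n) (k : ℕ) (D : ℕ → ℕ) : Prop :=
  Function.Injective (fun t : Fin k => L (D t)) ∧ ∃ x y : Fin k → ℝ,
    Packs I.N I.N (fun t : Fin k => (slotW L k D t : ℝ)) (fun t : Fin k => (slotH L k D t : ℝ)) x y ∧
    ∀ t : Fin k,
      D (t + 2 * k) = endsBelow x (fun t => (slotW L k D t : ℝ)) (x t) ∧
      D (t + 3 * k) = endsBelow x (fun t => (slotW L k D t : ℝ)) (x t + slotW L k D t) ∧
      D (t + 4 * k) = endsBelow y (fun t => (slotH L k D t : ℝ)) (y t) ∧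
      D (t + 5 * k) = endsBelow y (fun t => (slotH L k D t : ℝ)) (y t + slotH L k D t)

theorem Encodes.congr {L : ℕ → Fin I.n} {k : ℕ} {D D' : ℕ → ℕ} (h : Encodes L k D)
    (hD : ∀ p < 6 * k, D' p = D p) : Encodes L k D' := by
  have e0 : ∀ t : Fin k, D' t = D t := fun t => hD _ (by have := t.2; omega)
  have e1 : ∀ t : Fin k, D' (t + k) = D (t + k) := fun t => hD _ (by have := t.2; omega)
  have e2 : ∀ t : Fin k, D' (t + 2 * k) = D (t + 2 * k) := fun t => hD _ (by have := t.2; omega)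
  have e3 : ∀ t : Fin k, D' (t + 3 * k) = D (t + 3 * k) := fun t => hD _ (by have := t.2; omega)
  have e4 : ∀ t : Fin k, D' (t + 4 * k) = D (t + 4 * k) := fun t => hD _ (by have := t.2; omega)
  have e5 : ∀ t : Fin k, D' (t + 5 * k) = D (t + 5 * k) := fun t => hD _ (by have := t.2; omega)
  have eW : ∀ t : Fin k, slotW L k D' t = slotW L k D t := fun t => by simp [slotW, e0, e1]
  have eH : ∀ t : Fin k, slotH L k D' t = slotH L k D t := fun t => by simp [slotH, e0, e1]
  unfold Encodes at h ⊢
  simpa only [e0, eW, eH, e2, e3, e4, e5] using h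

/-- Positions computed from the labels form a packing whenever the labels come from one. -/
theorem Encodes.fits {L : ℕ → Fin I.n} {k : ℕ} {D X Y : ℕ → ℕ} (h : Encodes L k D)
    (hX : (∀ t < k, D (t + 2 * k) < D (t + 3 * k)) → ∃ G,
      IsLines k (fun t => D (t + 2 * k)) (fun t => D (t + 3 * k)) (slotW L k D) G ∧
        ∀ t < k, X t = G (D (t + 2 * k)))
    (hY : (∀ t < k, D (t + 4 * k) < D (t + 5 * k)) → ∃ G,
      IsLines k (fun t => D (t + 4 * k)) (fun t => D (t + 5 * k)) (slotH L k D) G ∧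
        ∀ t < k, Y t = G (D (t + 4 * k))) :
    ∀ t < k, X t + slotW L k D t ≤ I.N ∧ Y t + slotH L k D t ≤ I.N ∧ ∀ u < t,
      (L (D u) : ℕ) ≠ L (D t) ∧ (X u + slotW L k D u ≤ X t ∨ X t + slotW L k D t ≤ X u ∨
        Y u + slotH L k D u ≤ Y t ∨ Y t + slotH L k D t ≤ Y u) := by
  obtain ⟨hinj, x, y, hp, hlab⟩ := h
  have hWpos : ∀ t : ℕ, 0 < slotW L k D t := fun t => I.hor_pos _ _
  have hHpos : ∀ t : ℕ, 0 < slotH L k D t := fun t => I.ver_pos _ _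
  obtain ⟨G, hG, hXG⟩ := hX fun t ht => by
    lift t to Fin k using ht
    rw [(hlab t).1, (hlab t).2.1]
    exact endsBelow_lt (h := fun t : Fin k => (slotW L k D t : ℝ))
      (by have : (0 : ℝ) < slotW L k D t := by exact_mod_cast hWpos t
          linarith)
  obtain ⟨G', hG', hYG⟩ := hY fun t ht => by
    lift t to Fin k using ht
    rw [(hlab t).2.2.1, (hlab t).2.2.2]
    exact endsBelow_lt (h := fun t : Fin k => (slotH L k D t : ℝ))
      (by have : (0 : ℝ) < slotH L k D t := by exact_mod_cast hHpos t
          linarith)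
  have hlo := fun t => (hlab t).1
  have hhi := fun t => (hlab t).2.1
  have hlo' := fun t => (hlab t).2.2.1
  have hhi' := fun t => (hlab t).2.2.2
  intro t ht
  lift t to Fin k using ht
  have hXt : (X t : ℝ) ≤ x t := by
    rw [hXG t t.2]
    exact hG.le (fun t => hWpos t) hlo hhi hp.x_nonneg _ _ (hp.x_nonneg t) (hlo t).le
  have hYt : (Y t : ℝ) ≤ y t := by
    rw [hYG t t.2]
    exact hG'.le (fun t => hHpos t) hlo' hhi' hp.y_nonneg _ _ (hp.y_nonneg t) (hlo' t).le
  refine ⟨?_, ?_, fun u hu => ?_⟩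
  · have := hp.x_le t
    have h2 : (X t : ℝ) + slotW L k D t ≤ I.N := by linarith
    exact_mod_cast h2
  · have := hp.y_le t
    have h2 : (Y t : ℝ) + slotH L k D t ≤ I.N := by linarith
    exact_mod_cast h2
  · lift u to Fin k using hu.trans t.2
    have hne : u ≠ t := fun h => by simp [h] at hu
    refine ⟨fun h => hne (hinj (Fin.ext h)), ?_⟩
    rw [hXG t t.2, hXG u u.2, hYG t t.2, hYG u u.2]
    rcases hp.sep u t hne with h | h | h | h
    · exact .inl (hG.sep hlo hhi h)
    · exact .inr (.inl (hG.sep hlo hhi h))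
    · exact .inr (.inr (.inl (hG'.sep hlo' hhi' h)))
    · exact .inr (.inr (.inr (hG'.sep hlo' hhi' h)))

/-- Every packing of `k` items from a list of length `m` is encoded by `6 k` digits in base
`m + k + 1`. -/
theorem HasSolution.encodes {S : Finset (Fin I.n)} {k m : ℕ} {L : ℕ → Fin I.n}
    (h : I.HasSolution S k I.N I.N) (hL : ∀ i ∈ S, ∃ p < m, L p = i) :
    ∃ i < (m + k + 1) ^ (6 * k), Encodes L k fun p => i / (m + k + 1) ^ p % (m + k + 1) := by
  rw [hasSolution_iff] at h
  obtain ⟨f, r, x, y, hf, hS, hp⟩ := h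
  choose a ha haL using fun t => hL _ (hS t)
  -- `A j t` is the digit at `t + j k`.
  let w : Fin k → ℝ := fun t => I.hor (f t) (r t)
  let v : Fin k → ℝ := fun t => I.ver (f t) (r t)
  let A : ℕ → Fin k → ℕ := fun j t => match j with
    | 0 => a t
    | 1 => (r t).toNat
    | 2 => endsBelow x w (x t)
    | 3 => endsBelow x w (x t + w t)
    | 4 => endsBelow y v (y t)
    | _ => endsBelow y v (y t + v t)
  let D : ℕ → ℕ := fun p => if hk : 0 < k then A (p / k) ⟨p % k, Nat.mod_lt _ hk⟩ else 0
  have hDA : ∀ (t : Fin k) (j : ℕ), D (t + j * k) = A j t := by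
    intro t j
    have hk : 0 < k := t.pos
    simp only [D, hk, dif_pos]
    congr 1
    · rw [Nat.add_mul_div_right _ _ hk, Nat.div_eq_of_lt t.2, zero_add]
    · ext
      simp [Nat.mod_eq_of_lt t.2]
  have hAB : ∀ j t, A j t < m + k + 1 := by
    intro j t
    have h1 := t.pos
    have h2 : ∀ (y h : Fin k → ℝ) z, endsBelow y h z ≤ k :=
      fun y h z => (endsBelow_le y h z).trans (by simp)
    match j with
    | 0 => have := ha t; simp only [A]; omega
    | 1 => have := Bool.toNat_le (r t); simp only [A]; omega
    | 2 => have := h2 x w (x t); simp only [A]; omega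
    | 3 => have := h2 x w (x t + w t); simp only [A]; omega
    | 4 => have := h2 y v (y t); simp only [A]; omega
    | _ + 5 => have := h2 y v (y t + v t); simp only [A]; omega
  obtain ⟨i, hi, hiD⟩ := exists_digits (B := m + k + 1) (6 * k) D fun p hp => by
    have hk : 0 < k := by omega
    simp only [D, hk, dif_pos]
    exact hAB _ _
  refine ⟨i, hi, Encodes.congr (D := D) ?_ hiD⟩
  have e0 : ∀ t : Fin k, D t = a t := fun t => (congrArg D (by simp)).trans (hDA t 0)
  have e1 : ∀ t : Fin k, D (t + k) = (r t).toNat := fun t => (congrArg D (by simp)).trans (hDA t 1)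
  have eW : ∀ t : Fin k, slotW L k D t = I.hor (f t) (r t) := fun t => by
    simp only [slotW, e0, e1, haL]
    cases r t <;> rfl
  have eH : ∀ t : Fin k, slotH L k D t = I.ver (f t) (r t) := fun t => by
    simp only [slotH, e0, e1, haL]
    cases r t <;> rfl
  refine ⟨fun t u htu => hf (by simpa [e0, haL] using htu), x, y, ?_, fun t => ?_⟩
  · simpa only [eW, eH] using hp
  · simp only [eW, eH, hDA]
    exact ⟨rfl, rfl, rfl, rfl⟩

end KnapsackInstance

/-! ### Testing one sequence of digits

Registers `12` to `17` hold `k`, `2 k`, …, `6 k`, array `9` the list of kernel items and array `10`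
the digits. Arrays `11`, `12`, `13` receive the items, widths and heights of the slots, arrays `15`
and `16` their positions. -/

namespace RAM

/-- Decode the item and the dimensions of every slot. -/
def Program.decode : Program :=
  .count 20 (.reg 0)
    (.seq (.store 11 (.reg 20) (.read 9 (.read 10 (.reg 20))))
      (.branch (.read 10 (.add (.reg 20) (.reg 12)))
        (.seq (.store 12 (.reg 20) (.read 1 (.read 11 (.reg 20))))
          (.store 13 (.reg 20) (.read 0 (.read 11 (.reg 20)))))
        (.seq (.store 12 (.reg 20) (.read 0 (.read 11 (.reg 20))))
          (.store 13 (.reg 20) (.read 1 (.read 11 (.reg 20)))))))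

/-- Compute the line heights in array `14`, for lengths in array `W` and labels at the offsets
stored in registers `a` and `b`, and from them the coordinates in array `X`. -/
def Program.lines (a b W X : ℕ) : Program :=
  .seq
    (.count 20 (.add (.reg 0) (.lit 1))
      (.seq (.assign 22 (.lit 0))
      (.seq
        (.count 21 (.reg 0)
          (.branch (.ifLe (.read 10 (.add (.reg 21) (.reg b))) (.reg 20))
            (.assign 22 (.add (.reg 22) (.sub
              (.add (.read 14 (.read 10 (.add (.reg 21) (.reg a)))) (.read W (.reg 21)))
              (.reg 22))))
            .skip))
        (.store 14 (.reg 20) (.reg 22)))))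
    (.count 20 (.reg 0)
      (.store X (.reg 20) (.read 14 (.read 10 (.add (.reg 20) (.reg a))))))

/-- Count in register `23` the violated constraints. -/
def Program.test : Program :=
  .seq (.assign 23 (.lit 0))
    (.count 20 (.reg 0)
      (.seq
        (.assign 23 (.add (.reg 23) (.add
          (.sub (.add (.read 15 (.reg 20)) (.read 12 (.reg 20))) (.reg 2))
          (.sub (.add (.read 16 (.reg 20)) (.read 13 (.reg 20))) (.reg 2)))))
        (.count 21 (.reg 20)
          (.assign 23 (.add (.reg 23) (.add
            (.ifEq (.read 11 (.reg 21)) (.read 11 (.reg 20)))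
            (.sub (.lit 1) (.add
              (.add
                (.ifLe (.add (.read 15 (.reg 21)) (.read 12 (.reg 21))) (.read 15 (.reg 20)))
                (.ifLe (.add (.read 15 (.reg 20)) (.read 12 (.reg 20))) (.read 15 (.reg 21))))
              (.add
                (.ifLe (.add (.read 16 (.reg 21)) (.read 13 (.reg 21))) (.read 16 (.reg 20)))
                (.ifLe (.add (.read 16 (.reg 20)) (.read 13 (.reg 20)))
                  (.read 16 (.reg 21))))))))))))

/-- Write the output. -/
def Program.output : Program :=
  .count 20 (.reg 0)
    (.seq (.store 2 (.read 11 (.reg 20)) (.lit 1))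
    (.seq (.store 3 (.read 11 (.reg 20)) (.read 10 (.add (.reg 20) (.reg 12))))
    (.seq (.store 4 (.read 11 (.reg 20)) (.read 15 (.reg 20)))
      (.store 5 (.read 11 (.reg 20)) (.read 16 (.reg 20))))))

/-- Increment the number with digits in array `10`; register `24` receives the carry. -/
def Program.increment : Program :=
  .seq (.assign 24 (.lit 1))
    (.count 20 (.reg 17)
      (.seq (.assign 22 (.add (.read 10 (.reg 20)) (.reg 24)))
        (.branch (.ifEq (.reg 22) (.reg 11))
          (.seq (.store 10 (.reg 20) (.lit 0)) (.assign 24 (.lit 1)))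
          (.seq (.store 10 (.reg 20) (.reg 22)) (.assign 24 (.lit 0))))))

theorem ends_decode (s : State) :
    Ends .decode s (100 * (s.reg 0 + 1)) fun s' => ∀ t < s.reg 0,
      s'.arr 11 t = s.arr 9 (s.arr 10 t) ∧
      s'.arr 12 t = (if s.arr 10 (t + s.reg 12) ≠ 0 then s.arr 1 (s.arr 9 (s.arr 10 t))
        else s.arr 0 (s.arr 9 (s.arr 10 t))) ∧
      s'.arr 13 t = (if s.arr 10 (t + s.reg 12) ≠ 0 then s.arr 0 (s.arr 9 (s.arr 10 t))
        else s.arr 1 (s.arr 9 (s.arr 10 t))) := by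
  refine (Ends.count (e := .reg 0) (m := s.reg 0) (fun m s' => ∀ t < m,
      s'.arr 11 t = s.arr 9 (s.arr 10 t) ∧
      s'.arr 12 t = (if s.arr 10 (t + s.reg 12) ≠ 0 then s.arr 1 (s.arr 9 (s.arr 10 t))
        else s.arr 0 (s.arr 9 (s.arr 10 t))) ∧
      s'.arr 13 t = (if s.arr 10 (t + s.reg 12) ≠ 0 then s.arr 0 (s.arr 9 (s.arr 10 t))
        else s.arr 1 (s.arr 9 (s.arr 10 t)))) (fun s' hf => hf.reg 0 (by decide))
    (by decide) (by simp) (fun i s' him hf hi hinv => Ends.straight rfl ?_) fun s' h => h).mono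
    ?_ fun _ _ h => h
  · have h12 := hf.reg 12 (by decide)
    have h0 := hf.arr 0 (by decide)
    have h1 := hf.arr 1 (by decide)
    have h9 := hf.arr 9 (by decide)
    have h10 := hf.arr 10 (by decide)
    intro t ht
    by_cases hti : t = i
    · subst hti
      by_cases hr : s.arr 10 (t + s.reg 12) = 0 <;>
        simp [Program.exec, Expr.eval, hi, h12, h0, h1, h9, h10, hr]
    · have := hinv t (by omega)
      by_cases hr : s.arr 10 (i + s.reg 12) = 0 <;>
        simpa [Program.exec, Expr.eval, hi, h12, h0, h1, h9, h10, hr, hti] using this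
  · simp only [Expr.cost, Program.size]
    omega

theorem ends_lines {a b W X : ℕ} (ha : a < 20) (hb : b < 20) (hW : W < 14) (hX : 14 < X)
    (s : State) :
    Ends (.lines a b W X) s (100 * ((s.reg 0 + 2) * (s.reg 0 + 2))) fun s' =>
      (∀ t < s.reg 0, s.arr 10 (t + s.reg a) < s.arr 10 (t + s.reg b)) → ∃ G,
        IsLines (s.reg 0) (fun t => s.arr 10 (t + s.reg a)) (fun t => s.arr 10 (t + s.reg b))
          (s.arr W) G ∧ ∀ t < s.reg 0, s'.arr X t = G (s.arr 10 (t + s.reg a)) := by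
  set k := s.reg 0 with hk
  set lo : ℕ → ℕ := fun t => s.arr 10 (t + s.reg a) with hlo
  set hi : ℕ → ℕ := fun t => s.arr 10 (t + s.reg b) with hhi
  refine (Ends.seq (T₁ := (k + 2) * (2 + ((k + 1) * 50 + 3) + 12)) (Q₁ := fun s' =>
    (∀ t < k, lo t < hi t) → IsLines k lo hi (s.arr W) (s'.arr 14)) ?_
    fun s₁ hf₁ h₁ => (?_ : Ends _ _ ((k + 1) * 20) _)).mono ?_ fun _ _ h => h
  · refine (Ends.count (m := k + 1) (T := 2 + ((k + 1) * 50 + 3)) (fun m s' =>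
      (∀ t < k, lo t < hi t) → ∀ L < m, s'.arr 14 L = (Finset.range k).sup fun t =>
        if hi t ≤ L then s'.arr 14 (lo t) + s.arr W t else 0) (fun s' hf => ?_) (by simp)
      (by simp) (fun L s' hL hf h20 hinv => ?_) fun s' h hlt L hL => h hlt L (by omega)).mono ?_
      fun _ _ h => h
    · simp [Expr.eval, hf.reg 0 (by simp), hk]
    · have h0 := hf.reg 0 (by simp)
      have e_a := hf.reg a (by simp; omega)
      have e_b := hf.reg b (by simp; omega)
      have e10 := hf.arr 10 (by simp)
      have eW := hf.arr W (by simp; omega)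
      refine Ends.seq (T₁ := 2) (Q₁ := fun s₁ => s₁.reg 22 = 0)
        (Ends.straight rfl (by simp [Program.exec, Expr.eval])) fun s₁ hf₁ h122 => ?_
      replace h0 := (hf₁.reg 0 (by simp)).trans h0
      replace h20 := (hf₁.reg 20 (by simp)).trans h20
      replace e_a := (hf₁.reg a (by simp; omega)).trans e_a
      replace e_b := (hf₁.reg b (by simp; omega)).trans e_b
      replace e10 := (hf₁.arr 10 (by simp)).trans e10
      replace eW := (hf₁.arr W (by simp)).trans eW
      have e14 := hf₁.arr 14 (by simp)
      refine Ends.seq (T₁ := (k + 1) * 50) (Q₁ := fun s₂ => s₂.reg 22 =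
        (Finset.range k).sup fun t => if hi t ≤ L then s'.arr 14 (lo t) + s.arr W t else 0) ?_
        fun s₂ hf₂ h222 => ?_
      · refine (Ends.count (m := k) (fun m s₂ => s₂.reg 22 = (Finset.range m).sup fun t =>
          if hi t ≤ L then s'.arr 14 (lo t) + s.arr W t else 0) (fun s' hf => ?_) (by simp)
          (by simpa using h122) (fun t s₂ htk hf₂ h21 h222 => Ends.straight rfl ?_)
          fun s' h => h).mono (Nat.mul_le_mul_left _ (by
            simp [Program.size, Expr.cost, Expr.ifLe])) fun _ _ h => h
        · simpa [Expr.eval, h0] using hf.reg 0 (by simp)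
        · have e20 := (hf₂.reg 20 (by simp)).trans h20
          replace e_a := (hf₂.reg a (by simp; omega)).trans e_a
          replace e_b := (hf₂.reg b (by simp; omega)).trans e_b
          replace e10 := (hf₂.arr 10 (by simp)).trans e10
          replace eW := (hf₂.arr W (by simp)).trans eW
          replace e14 := (hf₂.arr 14 (by simp)).trans e14
          rw [Finset.range_add_one, Finset.sup_insert, ← h222]
          have e1 : hi t = s₂.arr 10 (t + s₂.reg b) := by rw [e10, e_b]
          have e2 : lo t = s₂.arr 10 (t + s₂.reg a) := by rw [e10, e_a]
          rw [e1, e2, ← e14, ← eW]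
          simp only [Program.exec, Expr.eval, Expr.eval_ifLe, h21, e20]
          by_cases h : s₂.arr 10 (t + s₂.reg b) ≤ L
          · simp [h]
            omega
          · simp [h]
      · replace h20 := (hf₂.reg 20 (by simp)).trans h20
        replace e14 := (hf₂.arr 14 (by simp)).trans e14
        refine Ends.straight (p := .store 14 _ _) rfl fun hlt L' hL' => ?_
        simp only [Program.exec, Expr.eval, h20, h222, State.setReg_arr, State.setArr_arr, e14,
          true_and]
        -- A rectangle with `hi t ≤ L'` starts on a line below `L`, which the assignment leaves alone.
        have hsup : ∀ c : ℕ, ((Finset.range k).sup fun t =>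
            if hi t ≤ L' then (if lo t = L then c else s'.arr 14 (lo t)) + s.arr W t else 0)
            = (Finset.range k).sup fun t =>
              if hi t ≤ L' then s'.arr 14 (lo t) + s.arr W t else 0 := fun c =>
          Finset.sup_congr rfl fun t ht => by
            have := hlt t (Finset.mem_range.1 ht)
            by_cases h : hi t ≤ L'
            · rw [if_pos h, if_pos h, if_neg (by omega)]
            · rw [if_neg h, if_neg h]
        rw [hsup]
        by_cases h : L' = L
        · subst h
          simp
        · rw [if_neg h]
          exact hinv hlt L' (by omega)
    · simp only [Expr.cost]
      nlinarith
  · have h0 := hf₁.reg 0 (by simp)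
    have e_a := hf₁.reg a (by simp; omega)
    have e10 := hf₁.arr 10 (by simp)
    refine (Ends.count (m := k) (fun m s' => ∀ t < m, s'.arr X t = s₁.arr 14 (lo t))
      (fun s' hf => ?_) (by simp) (by simp) (fun t s' htk hf h20 hinv => Ends.straight rfl ?_)
      fun s' h hlt => ⟨s₁.arr 14, h₁ hlt, h⟩).mono (by simp [Program.size, Expr.cost])
      fun _ _ h => h
    · simpa [Expr.eval, h0] using hf.reg 0 (by simp)
    · replace e_a := (hf.reg a (by simp; omega)).trans e_a
      replace e10 := (hf.arr 10 (by simp; omega)).trans e10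
      have e14 := hf.arr 14 (by simp; omega)
      intro t' ht'
      rcases Nat.lt_succ_iff_lt_or_eq.1 ht' with h | rfl
      · simpa [Program.exec, Expr.eval, h20, h.ne] using hinv t' h
      · simp [Program.exec, Expr.eval, h20, e_a, e10, e14, hlo]
  · nlinarith

/-- The number added by a pair of slots vanishes iff the items differ and one of the four ways to be
separated holds. -/
theorem add_violation_eq_zero_iff (c : ℕ) {p a b d e : Prop} [Decidable p] [Decidable a]
    [Decidable b] [Decidable d] [Decidable e] :
    c + ((if p then 1 else 0) + (1 - ((if a then 1 else 0) + (if b then 1 else 0) +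
      ((if d then 1 else 0) + (if e then 1 else 0))))) = 0 ↔ c = 0 ∧ ¬ p ∧ (a ∨ b ∨ d ∨ e) := by
  by_cases p <;> by_cases a <;> by_cases b <;> by_cases d <;> by_cases e <;> simp [*]

theorem ends_test (s : State) :
    Ends .test s (200 * ((s.reg 0 + 1) * (s.reg 0 + 1))) fun s' => s'.reg 23 = 0 ↔
      ∀ t < s.reg 0, s.arr 15 t + s.arr 12 t ≤ s.reg 2 ∧ s.arr 16 t + s.arr 13 t ≤ s.reg 2 ∧
        ∀ u < t, s.arr 11 u ≠ s.arr 11 t ∧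
          (s.arr 15 u + s.arr 12 u ≤ s.arr 15 t ∨ s.arr 15 t + s.arr 12 t ≤ s.arr 15 u ∨
            s.arr 16 u + s.arr 13 u ≤ s.arr 16 t ∨ s.arr 16 t + s.arr 13 t ≤ s.arr 16 u) := by
  set k := s.reg 0 with hk
  set P : ℕ → ℕ → Prop := fun t u => s.arr 11 u ≠ s.arr 11 t ∧
          (s.arr 15 u + s.arr 12 u ≤ s.arr 15 t ∨ s.arr 15 t + s.arr 12 t ≤ s.arr 15 u ∨
            s.arr 16 u + s.arr 13 u ≤ s.arr 16 t ∨ s.arr 16 t + s.arr 13 t ≤ s.arr 16 u) with hP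
  refine (Ends.seq (T₁ := 2) (Q₁ := fun s₁ => s₁.reg 23 = 0)
    (Ends.straight rfl (by simp [Program.exec, Expr.eval])) fun s₁ hf₁ h₁ =>
    Ends.count (e := .reg 0) (m := k) (T := 18 + (k + 1) * 100)
      (fun m s' => s'.reg 23 = 0 ↔ ∀ t < m, s.arr 15 t + s.arr 12 t ≤ s.reg 2 ∧
        s.arr 16 t + s.arr 13 t ≤ s.reg 2 ∧ ∀ u < t, P t u)
      (fun s' hf => (hf.reg 0 (by decide)).trans (hf₁.reg 0 (by decide))) (by decide)
      (by simpa using h₁) (fun t s' htk hf h20 hinv => ?_) fun s' h => h).mono ?_ fun _ _ h => h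
  · have h2 := (hf.reg 2 (by decide)).trans (hf₁.reg 2 (by decide))
    have h11 := (hf.arr 11 (by decide)).trans (hf₁.arr 11 (by decide))
    have h12 := (hf.arr 12 (by decide)).trans (hf₁.arr 12 (by decide))
    have h13 := (hf.arr 13 (by decide)).trans (hf₁.arr 13 (by decide))
    have h15 := (hf.arr 15 (by decide)).trans (hf₁.arr 15 (by decide))
    have h16 := (hf.arr 16 (by decide)).trans (hf₁.arr 16 (by decide))
    refine (Ends.seq (T₁ := 18) (Q₁ := fun s₂ => s₂.reg 23 = 0 ↔ (∀ t' < t,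
        s.arr 15 t' + s.arr 12 t' ≤ s.reg 2 ∧ s.arr 16 t' + s.arr 13 t' ≤ s.reg 2 ∧
        ∀ u < t', P t' u) ∧ s.arr 15 t + s.arr 12 t ≤ s.reg 2 ∧ s.arr 16 t + s.arr 13 t ≤ s.reg 2)
      (Ends.straight rfl ?_) fun s₂ hf₂ h₂ => ?_)
    · rw [← hinv]
      simp [Program.exec, Expr.eval, h20, h2, h12, h13, h15, h16]
      omega
    · replace h20 := (hf₂.reg 20 (by decide)).trans h20
      replace h11 := (hf₂.arr 11 (by decide)).trans h11
      replace h12 := (hf₂.arr 12 (by decide)).trans h12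
      replace h13 := (hf₂.arr 13 (by decide)).trans h13
      replace h15 := (hf₂.arr 15 (by decide)).trans h15
      replace h16 := (hf₂.arr 16 (by decide)).trans h16
      refine (Ends.count (e := .reg 20) (m := t) (fun m s₃ => s₃.reg 23 = 0 ↔ s₂.reg 23 = 0 ∧ ∀ u < m, P t u)
        (fun s' hf => (hf.reg 20 (by decide)).trans h20) (by decide) (by simp)
        (fun u s₃ hut hf₃ h21 hinv => Ends.straight rfl ?_) fun s₃ h => ?_).mono
        (Nat.mul_le_mul (by omega) (by simp [Program.size, Expr.cost, Expr.ifLe, Expr.ifEq]))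
        fun _ _ h => h
      · replace h20 := (hf₃.reg 20 (by decide)).trans h20
        replace h11 := (hf₃.arr 11 (by decide)).trans h11
        replace h12 := (hf₃.arr 12 (by decide)).trans h12
        replace h13 := (hf₃.arr 13 (by decide)).trans h13
        replace h15 := (hf₃.arr 15 (by decide)).trans h15
        replace h16 := (hf₃.arr 16 (by decide)).trans h16
        have hsucc : (∀ v < u + 1, P t v) ↔ (∀ v < u, P t v) ∧ P t u := Nat.forall_lt_succ_right
        rw [hsucc, ← and_assoc, ← hinv]
        simp only [Program.exec, Expr.eval, Expr.eval_ifLe, Expr.eval_ifEq, h20, h21, h11, h12,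
          h13, h15, h16, hP, State.setReg_reg]
        rw [if_pos trivial]
        exact add_violation_eq_zero_iff _
      · have hsucc : (∀ v < t + 1, s.arr 15 v + s.arr 12 v ≤ s.reg 2 ∧
            s.arr 16 v + s.arr 13 v ≤ s.reg 2 ∧ ∀ u < v, P v u) ↔ _ := Nat.forall_lt_succ_right
        rw [hsucc]
        simp only [State.setReg_reg, if_neg (show (23 : ℕ) ≠ 20 by decide), h, h₂]
        tauto
  · simp only [Expr.cost]
    nlinarith

theorem ends_output {s : State} (hz : ∀ m, s.arr 2 m = 0)
    (hinj : ∀ t < s.reg 0, ∀ u < t, s.arr 11 u ≠ s.arr 11 t) :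
    Ends .output s (100 * (s.reg 0 + 1)) fun s' =>
      (∀ m, s'.arr 2 m ≠ 0 ↔ ∃ t < s.reg 0, s.arr 11 t = m) ∧
      ∀ t < s.reg 0, s'.arr 3 (s.arr 11 t) = s.arr 10 (t + s.reg 12) ∧
        s'.arr 4 (s.arr 11 t) = s.arr 15 t ∧ s'.arr 5 (s.arr 11 t) = s.arr 16 t := by
  refine (Ends.count (e := .reg 0) (m := s.reg 0) (fun m s' =>
      (∀ i, s'.arr 2 i ≠ 0 ↔ ∃ t < m, s.arr 11 t = i) ∧
      ∀ t < m, s'.arr 3 (s.arr 11 t) = s.arr 10 (t + s.reg 12) ∧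
        s'.arr 4 (s.arr 11 t) = s.arr 15 t ∧ s'.arr 5 (s.arr 11 t) = s.arr 16 t)
    (fun s' hf => hf.reg 0 (by decide)) (by decide) (by simp [hz])
    (fun t s' him hf h20 hinv => Ends.straight rfl ?_) fun s' h => h).mono ?_ fun _ _ h => h
  · have h12 := hf.reg 12 (by decide)
    have h10 := hf.arr 10 (by decide)
    have h11 := hf.arr 11 (by decide)
    have h15 := hf.arr 15 (by decide)
    have h16 := hf.arr 16 (by decide)
    refine ⟨fun i => ?_, fun t' ht' => ?_⟩
    · have hsucc : (∃ u < t + 1, s.arr 11 u = i) ↔ _ := Nat.exists_lt_succ_right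
      rw [hsucc, ← hinv.1 i]
      by_cases h : i = s.arr 11 t
      · simp [Program.exec, Expr.eval, h20, h11, h]
      · simp [Program.exec, Expr.eval, h20, h11, h, Ne.symm h]
    · rcases Nat.lt_succ_iff_lt_or_eq.1 ht' with h | rfl
      · simpa [Program.exec, Expr.eval, h20, h11, hinj t him t' h] using hinv.2 t' h
      · simp [Program.exec, Expr.eval, h20, h10, h11, h12, h15, h16]
  · simp only [Expr.cost, Program.size]
    omega

theorem ends_increment {s : State} {i : ℕ} (hB : 0 < s.reg 11)
    (hD : ∀ p < s.reg 17, s.arr 10 p = i / s.reg 11 ^ p % s.reg 11) :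
    Ends .increment s (100 * (s.reg 17 + 1)) fun s' =>
      (∀ p < s.reg 17, s'.arr 10 p = (i + 1) / s.reg 11 ^ p % s.reg 11) ∧
      s'.reg 24 = if s.reg 11 ^ s.reg 17 ∣ i + 1 then 1 else 0 := by
  refine (Ends.seq (T₁ := 2) (Q₁ := fun s₁ => s₁.reg 24 = 1)
    (Ends.straight rfl (by simp [Program.exec, Expr.eval])) fun s₁ hf₁ h₁ =>
    Ends.count (e := .reg 17) (m := s.reg 17) (fun m s' =>
      (∀ p < s.reg 17, s'.arr 10 p =
        if p < m then (i + 1) / s.reg 11 ^ p % s.reg 11 else i / s.reg 11 ^ p % s.reg 11) ∧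
      s'.reg 24 = if s.reg 11 ^ m ∣ i + 1 then 1 else 0)
      (fun s' hf => (hf.reg 17 (by decide)).trans (hf₁.reg 17 (by decide))) (by decide)
      ⟨fun p hp => ?_, by simp [h₁]⟩ (fun p s' hp hf h20 hinv => Ends.straight rfl ?_)
      fun s' h => ⟨fun p hp => by simpa [hp] using h.1 p hp, h.2⟩).mono ?_ fun _ _ h => h
  · simpa [hf₁.arr 10 (by decide)] using hD p hp
  · have h11 := (hf.reg 11 (by decide)).trans (hf₁.reg 11 (by decide))
    have hp10 := hinv.1 p hp
    rw [if_neg (lt_irrefl p)] at hp10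
    obtain ⟨d1, d2⟩ := digit_succ hB i p
    rw [← hinv.2] at d1 d2
    have hlt : ∀ p', p' ≠ p → (p' < p + 1 ↔ p' < p) := fun p' h => by omega
    by_cases h : i / s.reg 11 ^ p % s.reg 11 + s'.reg 24 = s.reg 11
    · refine ⟨fun p' hp' => ?_, ?_⟩
      · by_cases hpp : p' = p
        · subst hpp
          simp [Program.exec, Expr.eval, h20, h11, hp10, h, (d1 h).1]
        · simpa [Program.exec, Expr.eval, h20, h11, hp10, h, hpp, hlt p' hpp] using hinv.1 p' hp'
      · simp [Program.exec, Expr.eval, h20, h11, hp10, h, (d1 h).2]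
    · refine ⟨fun p' hp' => ?_, ?_⟩
      · by_cases hpp : p' = p
        · subst hpp
          simp [Program.exec, Expr.eval, h20, h11, hp10, h, (d2 h).1]
        · simpa [Program.exec, Expr.eval, h20, h11, hp10, h, hpp, hlt p' hpp] using hinv.1 p' hp'
      · simp [Program.exec, Expr.eval, h20, h11, hp10, h, (d2 h).2]
  · simp only [Expr.cost, Program.size, Expr.ifEq]
    omega

end RAM

/-! ### The search for a packing -/

namespace RAM

/-- Collect in array `9` the items marked in array `8`; register `10` counts them. -/
def Program.collect : Program :=
  .seq (.assign 10 (.lit 0))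
    (.count 20 (.reg 3)
      (.branch (.read 8 (.reg 20))
        (.seq (.store 9 (.reg 10) (.reg 20)) (.assign 10 (.add (.reg 10) (.lit 1))))
        .skip))

theorem ends_collect {s : State} (hz : ∀ p, s.arr 9 p = 0) :
    Ends .collect s (100 * (s.reg 3 + 1)) fun s' =>
      (∀ i < s.reg 3, s.arr 8 i ≠ 0 → ∃ p < s'.reg 10, s'.arr 9 p = i) ∧
      (∀ p, s'.arr 9 p = 0 ∨ s'.arr 9 p < s.reg 3) ∧
      s'.reg 10 = ∑ i ∈ Finset.range (s.reg 3), if s.arr 8 i ≠ 0 then 1 else 0 := by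
  refine (Ends.seq (T₁ := 2) (Q₁ := fun s₁ => s₁.reg 10 = 0)
    (Ends.straight rfl (by simp [Program.exec, Expr.eval])) fun s₁ hf₁ h₁ =>
    Ends.count (e := .reg 3) (m := s.reg 3) (fun m s' =>
      (∀ i < m, s.arr 8 i ≠ 0 → ∃ p < s'.reg 10, s'.arr 9 p = i) ∧
      (∀ p, s'.arr 9 p = 0 ∨ s'.arr 9 p < m) ∧
      s'.reg 10 = ∑ i ∈ Finset.range m, if s.arr 8 i ≠ 0 then 1 else 0)
      (fun s' hf => (hf.reg 3 (by decide)).trans (hf₁.reg 3 (by decide))) (by decide)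
      (by simp [hf₁.arr 9 (by decide), h₁, hz])
      (fun i s' hi hf h20 hinv => Ends.straight rfl ?_)
      fun s' h => h).mono ?_ fun _ _ h => h
  · have h8 := (hf.arr 8 (by decide)).trans (hf₁.arr 8 (by decide))
    obtain ⟨i1, i2, i3⟩ := hinv
    rw [Finset.sum_range_succ, ← i3]
    by_cases h : s.arr 8 i = 0
    · refine ⟨fun j hj hj0 => ?_, fun p => ?_, ?_⟩
      · have : j ≠ i := fun e => hj0 (e ▸ h)
        simpa [Program.exec, Expr.eval, h20, h8, h] using i1 j (by omega) hj0
      · have := i2 p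
        simp [Program.exec, Expr.eval, h20, h8, h]
        omega
      · simp [Program.exec, Expr.eval, h20, h8, h]
    · refine ⟨fun j hj hj0 => ?_, fun p => ?_, ?_⟩
      · by_cases hji : j = i
        · exact ⟨s'.reg 10, by simp [Program.exec, Expr.eval, h20, h8, h, hji]⟩
        · obtain ⟨p, hp, hpj⟩ := i1 j (by omega) hj0
          refine ⟨p, ?_, ?_⟩
          · simp [Program.exec, Expr.eval, h20, h8, h]
            omega
          · simpa [Program.exec, Expr.eval, h20, h8, h, hp.ne] using hpj
      · have := i2 p
        simp [Program.exec, Expr.eval, h20, h8, h]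
        split_ifs <;> omega
      · simp [Program.exec, Expr.eval, h20, h8, h]
  · simp only [Expr.cost, Program.size]
    omega

/-- Set the base of the digits, the multiples of `k`, and the flags. -/
def Program.prepare : Program :=
  .seq (.assign 11 (.add (.add (.reg 10) (.reg 0)) (.lit 1)))
  (.seq (.assign 12 (.reg 0))
  (.seq (.assign 13 (.add (.reg 12) (.reg 0)))
  (.seq (.assign 14 (.add (.reg 13) (.reg 0)))
  (.seq (.assign 15 (.add (.reg 14) (.reg 0)))
  (.seq (.assign 16 (.add (.reg 15) (.reg 0)))
  (.seq (.assign 17 (.add (.reg 16) (.reg 0)))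
  (.seq (.assign 24 (.lit 0)) (.assign 25 (.lit 0)))))))))

/-- Test the current digits, write the output if they yield a packing, and pass to the next
sequence of digits. -/
def Program.step : Program :=
  .seq .decode (.seq (.lines 13 14 12 15) (.seq (.lines 15 16 13 16) (.seq .test
    (.seq (.branch (.reg 23) .skip (.seq .output (.assign 25 (.lit 1)))) .increment))))

/-- Compute the kernel and try all sequences of digits, after the cases `k = 0`, where the empty
solution is output, and `n < k`, where there is none. -/
def Program.search : Program :=
  .branch (.reg 0)
    (.branch (.ifLe (.reg 0) (.reg 3))
      (.seq (.kernel 8) (.seq .collect (.seq .prepare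
        (.seq (.loop (.sub (.lit 1) (.add (.reg 24) (.reg 25))) .step)
          (.assign 0 (.reg 25))))))
      (.assign 0 (.lit 0)))
    (.assign 0 (.lit 1))

end RAM

namespace KnapsackInstance

open RAM

variable {I : KnapsackInstance}

theorem OutputsSolution.congr {k : ℕ} {s s' : State} (h : I.OutputsSolution k s)
    (h2 : s'.arr 2 = s.arr 2) (h3 : s'.arr 3 = s.arr 3) (h4 : s'.arr 4 = s.arr 4)
    (h5 : s'.arr 5 = s.arr 5) : I.OutputsSolution k s' := by
  unfold OutputsSolution outSet at *
  rwa [h2, h3, h4, h5]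

theorem outputsSolution_of_fits {L : ℕ → Fin I.n} {k : ℕ} {D X Y : ℕ → ℕ} {s : State}
    (hfit : ∀ t < k, X t + slotW L k D t ≤ I.N ∧ Y t + slotH L k D t ≤ I.N ∧ ∀ u < t,
      (L (D u) : ℕ) ≠ L (D t) ∧ (X u + slotW L k D u ≤ X t ∨ X t + slotW L k D t ≤ X u ∨
        Y u + slotH L k D u ≤ Y t ∨ Y t + slotH L k D t ≤ Y u))
    (h2 : ∀ m, s.arr 2 m ≠ 0 ↔ ∃ t < k, (L (D t) : ℕ) = m)
    (h3 : ∀ t < k, s.arr 3 (L (D t)) = D (t + k) ∧ s.arr 4 (L (D t)) = X t ∧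
      s.arr 5 (L (D t)) = Y t) : I.OutputsSolution k s := by
  have hmem : ∀ i, i ∈ I.outSet s ↔ ∃ t < k, L (D t) = i := fun i => by
    simp [outSet, h2, Fin.ext_iff]
  have hlt : ∀ {u t}, u < t → t < k → L (D u) ≠ L (D t) := fun hu ht h =>
    ((hfit _ ht).2.2 _ hu).1 (congrArg Fin.val h)
  refine ⟨?_, fun i hi => ?_, fun i hi j hj hij => ?_⟩
  · have : I.outSet s = (Finset.range k).image fun t => L (D t) := by
      ext i
      simp [hmem]
    rw [this, Finset.card_image_of_injOn, Finset.card_range]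
    intro t ht u hu htu
    simp only [Finset.coe_range, Set.mem_Iio] at ht hu
    rcases lt_trichotomy t u with h | h | h
    · exact (hlt h hu htu).elim
    · exact h
    · exact (hlt h ht htu.symm).elim
  · obtain ⟨t, ht, rfl⟩ := (hmem i).1 hi
    obtain ⟨e3, e4, e5⟩ := h3 t ht
    simp only [e3, e4, e5]
    rw [placed_subset_iff]
    obtain ⟨f1, f2, -⟩ := hfit t ht
    exact ⟨by positivity, by exact_mod_cast f1, by positivity, by exact_mod_cast f2⟩
  · obtain ⟨t, ht, rfl⟩ := (hmem i).1 hi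
    obtain ⟨u, hu, rfl⟩ := (hmem j).1 hj
    obtain ⟨e3, e4, e5⟩ := h3 t ht
    obtain ⟨d3, d4, d5⟩ := h3 u hu
    simp only [e3, e4, e5, d3, d4, d5]
    rw [disjoint_placed_iff]
    rcases lt_trichotomy t u with h | h | h
    · have := ((hfit u hu).2.2 t h).2
      simp only [slotW, slotH] at this
      exact_mod_cast this
    · exact (hij (by rw [h])).elim
    · have := ((hfit t ht).2.2 u h).2
      simp only [slotW, slotH] at this
      have h' : X t + I.hor (L (D t)) (decide (D (t + k) ≠ 0)) ≤ X u ∨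
          X u + I.hor (L (D u)) (decide (D (u + k) ≠ 0)) ≤ X t ∨
          Y t + I.ver (L (D t)) (decide (D (t + k) ≠ 0)) ≤ Y u ∨
          Y u + I.ver (L (D u)) (decide (D (u + k) ≠ 0)) ≤ Y t := by tauto
      exact_mod_cast h'

/-- What all iterations of the search have in common. -/
structure Prepared (I : KnapsackInstance) (k q m : ℕ) (L : ℕ → Fin I.n) (s : State) : Prop where
  loaded : I.Loaded k q s
  list : ∀ p, s.arr 9 p = L p
  reg11 : s.reg 11 = m + k + 1
  reg12 : s.reg 12 = k
  reg13 : s.reg 13 = 2 * k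
  reg14 : s.reg 14 = 3 * k
  reg15 : s.reg 15 = 4 * k
  reg16 : s.reg 16 = 5 * k
  reg17 : s.reg 17 = 6 * k

theorem Prepared.frame {k q m : ℕ} {L : ℕ → Fin I.n} {s s' : State} {p : Program}
    (h : I.Prepared k q m L s) (hf : Frame p s s') (hr : ∀ x < 18, x ∉ p.regs)
    (ha : ∀ A ∈ [0, 1, 9], A ∉ p.arrs) : I.Prepared k q m L s' where
  loaded := h.loaded.frame hf (fun x hx => hr x (by omega)) (fun A hA => ha A (by
    simp only [List.mem_cons]
    omega))
  list := by
    rw [hf.arr 9 (ha 9 (by decide))]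
    exact h.list
  reg11 := (hf.reg 11 (hr 11 (by decide))).trans h.reg11
  reg12 := (hf.reg 12 (hr 12 (by decide))).trans h.reg12
  reg13 := (hf.reg 13 (hr 13 (by decide))).trans h.reg13
  reg14 := (hf.reg 14 (hr 14 (by decide))).trans h.reg14
  reg15 := (hf.reg 15 (hr 15 (by decide))).trans h.reg15
  reg16 := (hf.reg 16 (hr 16 (by decide))).trans h.reg16
  reg17 := (hf.reg 17 (hr 17 (by decide))).trans h.reg17

/-- The invariant of the search before iteration `i`: a packing has been found, or none of the
numbers below `i` encodes one and the digits are those of `i`. -/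
structure Searching (I : KnapsackInstance) (k q m : ℕ) (L : ℕ → Fin I.n) (i : ℕ) (s : State) :
    Prop where
  prepared : I.Prepared k q m L s
  state : s.reg 25 = 1 ∧ I.OutputsSolution k s ∨ s.reg 25 = 0 ∧ (∀ p, s.arr 2 p = 0) ∧
    (∀ j < i, ¬ Encodes L k fun p => j / (m + k + 1) ^ p % (m + k + 1)) ∧
    (s.reg 24 = 0 ∧ i < (m + k + 1) ^ (6 * k) ∧
        (∀ p < 6 * k, s.arr 10 p = i / (m + k + 1) ^ p % (m + k + 1)) ∨
      s.reg 24 = 1 ∧ i = (m + k + 1) ^ (6 * k))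

theorem ends_step {k q m i : ℕ} {L : ℕ → Fin I.n} {s : State} (hs : I.Searching k q m L i s)
    (h24 : s.reg 24 = 0) (h25 : s.reg 25 = 0) :
    Ends .step s (2000 * ((k + 2) * (k + 2))) (I.Searching k q m L (i + 1)) := by
  obtain ⟨hp, hst⟩ := hs
  obtain ⟨hz, hno, hi, hD⟩ : (∀ p, s.arr 2 p = 0) ∧
      (∀ j < i, ¬ Encodes L k fun p => j / (m + k + 1) ^ p % (m + k + 1)) ∧
      i < (m + k + 1) ^ (6 * k) ∧
      (∀ p < 6 * k, s.arr 10 p = i / (m + k + 1) ^ p % (m + k + 1)) := by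
    rcases hst with ⟨h, -⟩ | ⟨-, hz, hno, ⟨-, hi, hD⟩ | ⟨h, -⟩⟩
    · omega
    · exact ⟨hz, hno, hi, hD⟩
    · omega
  set D := s.arr 10 with hDdef
  refine (Ends.seq (T₁ := 100 * (k + 1)) (Q₁ := fun s' => ∀ t < k, s'.arr 11 t = L (D t) ∧
      s'.arr 12 t = slotW L k D t ∧ s'.arr 13 t = slotH L k D t) ?_ fun s₁ hf₁ h₁ =>
    Ends.seq (T₁ := 100 * ((k + 2) * (k + 2))) (Q₁ := fun s' =>
      (∀ t < k, D (t + 2 * k) < D (t + 3 * k)) → ∃ G,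
      IsLines k (fun t => D (t + 2 * k)) (fun t => D (t + 3 * k)) (slotW L k D) G ∧
        ∀ t < k, s'.arr 15 t = G (D (t + 2 * k))) ?_ fun s₂ hf₂ h₂ =>
    Ends.seq (T₁ := 100 * ((k + 2) * (k + 2))) (Q₁ := fun s' =>
      (∀ t < k, D (t + 4 * k) < D (t + 5 * k)) → ∃ G,
      IsLines k (fun t => D (t + 4 * k)) (fun t => D (t + 5 * k)) (slotH L k D) G ∧
        ∀ t < k, s'.arr 16 t = G (D (t + 4 * k))) ?_ fun s₃ hf₃ h₃ => ?_).mono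
    (?_ : _ + (_ + (_ + 1500 * ((k + 2) * (k + 2)))) ≤ _) fun _ _ h => h
  · refine (ends_decode s).mono (by rw [hp.loaded.reg0]) fun s' _ h t ht => ?_
    obtain ⟨e1, e2, e3⟩ := h t (by rw [hp.loaded.reg0]; exact ht)
    rw [hp.list, hp.loaded.arr0, hp.loaded.arr1, hp.reg12] at e2 e3
    rw [hp.list] at e1
    refine ⟨e1, e2.trans ?_, e3.trans ?_⟩ <;>
      by_cases hr : D (t + k) = 0 <;> simp [slotW, slotH, hor, ver, hr, ← hDdef]
  · have hp₁ := hp.frame hf₁ (by decide) (by decide)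
    have hD₁ : s₁.arr 10 = D := hf₁.arr 10 (by decide)
    refine (ends_lines (by decide) (by decide) (by decide) (by decide) s₁).mono
      (by rw [hp₁.loaded.reg0]) fun s' _ h hlt => ?_
    rw [hp₁.loaded.reg0, hp₁.reg13, hp₁.reg14, hD₁] at h
    obtain ⟨G, hG, hX⟩ := h hlt
    exact ⟨G, hG.congr fun t ht => (h₁ t ht).2.1, hX⟩
  · have hp₁ := hp.frame hf₁ (by decide) (by decide)
    have hp₂ := hp₁.frame hf₂ (by decide) (by decide)
    have hD₂ : s₂.arr 10 = D := (hf₂.arr 10 (by decide)).trans (hf₁.arr 10 (by decide))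
    refine (ends_lines (by decide) (by decide) (by decide) (by decide) s₂).mono
      (by rw [hp₂.loaded.reg0]) fun s' _ h hlt => ?_
    rw [hp₂.loaded.reg0, hp₂.reg15, hp₂.reg16, hD₂] at h
    obtain ⟨G, hG, hX⟩ := h hlt
    refine ⟨G, hG.congr fun t ht => ?_, hX⟩
    rw [hf₂.arr 13 (by decide)]
    exact (h₁ t ht).2.2
  · have hp₁ := hp.frame hf₁ (by decide) (by decide)
    have hp₂ := hp₁.frame hf₂ (by decide) (by decide)
    have hp₃ := hp₂.frame hf₃ (by decide) (by decide)
    have f10 : s₃.arr 10 = D := (hf₃.arr 10 (by decide)).trans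
      ((hf₂.arr 10 (by decide)).trans (hf₁.arr 10 (by decide)))
    have f2 : s₃.arr 2 = s.arr 2 := (hf₃.arr 2 (by decide)).trans
      ((hf₂.arr 2 (by decide)).trans (hf₁.arr 2 (by decide)))
    have f25 : s₃.reg 25 = 0 := (hf₃.reg 25 (by decide)).trans
      ((hf₂.reg 25 (by decide)).trans ((hf₁.reg 25 (by decide)).trans h25))
    have f11 : ∀ t < k, s₃.arr 11 t = L (D t) := fun t ht => by
      rw [hf₃.arr 11 (by decide), hf₂.arr 11 (by decide)]
      exact (h₁ t ht).1
    have f12 : ∀ t < k, s₃.arr 12 t = slotW L k D t := fun t ht => by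
      rw [hf₃.arr 12 (by decide), hf₂.arr 12 (by decide)]
      exact (h₁ t ht).2.1
    have f13 : ∀ t < k, s₃.arr 13 t = slotH L k D t := fun t ht => by
      rw [hf₃.arr 13 (by decide), hf₂.arr 13 (by decide)]
      exact (h₁ t ht).2.2
    have f15 : s₃.arr 15 = s₂.arr 15 := hf₃.arr 15 (by decide)
    have hfits : Encodes L k D → _ := fun h => h.fits (X := s₃.arr 15) (Y := s₃.arr 16)
      (by rw [f15]; exact h₂) h₃
    set Fits := ∀ t < k, s₃.arr 15 t + slotW L k D t ≤ I.N ∧ s₃.arr 16 t + slotH L k D t ≤ I.N ∧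
      ∀ u < t, (L (D u) : ℕ) ≠ L (D t) ∧ (s₃.arr 15 u + slotW L k D u ≤ s₃.arr 15 t ∨
        s₃.arr 15 t + slotW L k D t ≤ s₃.arr 15 u ∨ s₃.arr 16 u + slotH L k D u ≤ s₃.arr 16 t ∨
        s₃.arr 16 t + slotH L k D t ≤ s₃.arr 16 u) with hFits
    refine (Ends.seq (T₁ := 200 * ((k + 1) * (k + 1))) (Q₁ := fun s' => s'.reg 23 = 0 ↔ Fits) ?_
      fun s₄ hf₄ h₄ => Ends.seq (T₁ := 110 * (k + 1)) (Q₁ := fun s' => I.Prepared k q m L s' ∧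
        s'.arr 10 = D ∧ (s'.reg 25 = 1 ∧ I.OutputsSolution k s' ∨
          s'.reg 25 = 0 ∧ (∀ p, s'.arr 2 p = 0) ∧ ¬ Encodes L k D)) ?_
        fun s₅ hf₅ ⟨hp₅, g10, h₅⟩ => (?_ : Ends _ _ (100 * (6 * k + 1)) _)).mono ?_
        fun _ _ h => h
    · refine (ends_test s₃).mono (by rw [hp₃.loaded.reg0]) fun s' _ h => h.trans ?_
      rw [hp₃.loaded.reg0, hp₃.loaded.reg2]
      refine forall₂_congr fun t ht => ?_
      rw [f12 t ht, f13 t ht, f11 t ht]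
      refine and_congr_right fun _ => and_congr_right fun _ => forall₂_congr fun u hu => ?_
      rw [f12 u (hu.trans ht), f13 u (hu.trans ht), f11 u (hu.trans ht)]
    · have hp₄ := hp₃.frame hf₄ (by decide) (by decide)
      have g2 : ∀ p, s₄.arr 2 p = 0 := fun p => by
        rw [hf₄.arr 2 (by decide), f2]
        exact hz p
      have g25 : s₄.reg 25 = 0 := (hf₄.reg 25 (by decide)).trans f25
      have g10 : s₄.arr 10 = D := (hf₄.arr 10 (by decide)).trans f10
      refine (Ends.branch (T := 100 * (k + 1) + 2) (fun h => ?_) fun h => ?_).mono (by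
        simp only [Expr.cost]; omega) fun _ _ h => h
      · refine (Ends.skip (Q := fun s' => _) ⟨hp₄, g10, .inr ⟨g25, g2, fun hE => ?_⟩⟩).mono
          (by omega) fun _ _ h => h
        exact h (h₄.2 (hfits hE))
      · have hF : Fits := h₄.1 h
        have g11 : ∀ t < k, s₄.arr 11 t = L (D t) := fun t ht => by
          rw [hf₄.arr 11 (by decide)]
          exact f11 t ht
        refine Ends.seq (T₁ := 100 * (k + 1)) ((ends_output g2 ?_).mono
          (by rw [hp₄.loaded.reg0]) fun _ _ h => h) fun s₅ hf₅ h₅ =>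
          Ends.straight (p := .assign 25 (.lit 1)) rfl ?_
        · rw [hp₄.loaded.reg0]
          intro t ht u hu
          rw [g11 t ht, g11 u (hu.trans ht)]
          exact ((hF t ht).2.2 u hu).1
        · have hp₅ := hp₄.frame hf₅ (by decide) (by decide)
          have hfr : Frame (.assign 25 (.lit 1)) s₅ (Program.exec (.assign 25 (.lit 1)) s₅) :=
            ⟨fun x hx => by
              have : x ≠ 25 := by simpa using hx
              simp [Program.exec, this], fun A _ => rfl⟩
          refine ⟨hp₅.frame hfr (by decide) (by decide), (hf₅.arr 10 (by decide)).trans g10,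
            .inl ⟨by simp [Program.exec, Expr.eval], ?_⟩⟩
          rw [hp₄.loaded.reg0, hp₄.reg12, g10] at h₅
          have hs₅ : I.OutputsSolution k s₅ := by
            refine outputsSolution_of_fits hF (fun p => (h₅.1 p).trans ?_) fun t ht => ?_
            · exact exists_congr fun t => and_congr_right fun ht => by rw [g11 t ht]
            · have := h₅.2 t ht
              rwa [g11 t ht, hf₄.arr 15 (by decide), hf₄.arr 16 (by decide)] at this
          exact hs₅.congr rfl rfl rfl rfl
    · refine (ends_increment (i := i) (by rw [hp₅.reg11]; omega) ?_).mono (by rw [hp₅.reg17])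
        fun s' hf' h' => ⟨hp₅.frame hf' (by decide) (by decide), ?_⟩
      · rw [hp₅.reg11, hp₅.reg17, g10]
        exact hD
      · rw [hp₅.reg11, hp₅.reg17] at h'
        rw [hf'.reg 25 (by decide), hf'.arr 2 (by decide)]
        rcases h₅ with ⟨e25, ho⟩ | ⟨e25, e2, hE⟩
        · exact .inl ⟨e25, ho.congr (hf'.arr 2 (by decide)) (hf'.arr 3 (by decide))
            (hf'.arr 4 (by decide)) (hf'.arr 5 (by decide))⟩
        · refine .inr ⟨e25, e2, fun j hj => ?_, ?_⟩
          · rcases Nat.lt_succ_iff_lt_or_eq.1 hj with h | rfl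
            · exact hno j h
            · exact fun h => hE (h.congr hD)
          · by_cases hd : (m + k + 1) ^ (6 * k) ∣ i + 1
            · refine .inr ⟨by rw [h'.2, if_pos hd], ?_⟩
              have := Nat.le_of_dvd (by omega) hd
              omega
            · refine .inl ⟨by rw [h'.2, if_neg hd], ?_, h'.1⟩
              refine lt_of_le_of_ne hi fun h => hd (h ▸ dvd_rfl)
    · nlinarith
  · nlinarith

/-- The number of digit sequences. The factor is `6 ^ 6`, for `q = k = 1`; otherwise `6 ≤ (q k) ^ 3`, so
that the base is at most `(q k) ^ 5`. -/
theorem base_pow_le {k q m : ℕ} (hk : 1 ≤ k) (hq : 1 ≤ q) (hm : m ≤ 4 * (q * k ^ 2)) :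
    (m + k + 1) ^ (6 * k) ≤ 46656 * (q * k) ^ (30 * k) := by
  have hB : m + k + 1 ≤ 6 * (q * k) ^ 2 := by
    have h1 : q * k ^ 2 ≤ (q * k) ^ 2 := by
      rw [mul_pow]
      exact Nat.mul_le_mul_right _ (Nat.le_self_pow (by norm_num) q)
    have h2 : 1 ≤ q * k := Nat.mul_pos hq hk
    have h3 : k ≤ q * k := Nat.le_mul_of_pos_left k hq
    nlinarith
  rcases Nat.lt_or_ge (q * k) 2 with h | h
  · have h1 : q * k = 1 := by
      have : 1 ≤ q * k := Nat.mul_pos hq hk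
      omega
    obtain rfl := Nat.eq_one_of_mul_eq_one_right h1
    obtain rfl := Nat.eq_one_of_mul_eq_one_left h1
    simp only [mul_one, one_pow] at hB ⊢
    exact Nat.pow_le_pow_left hB 6
  · have h1 : m + k + 1 ≤ (q * k) ^ 5 := by
      refine hB.trans ?_
      have : 2 ^ 3 ≤ (q * k) ^ 3 := Nat.pow_le_pow_left h 3
      calc 6 * (q * k) ^ 2 ≤ (q * k) ^ 3 * (q * k) ^ 2 := Nat.mul_le_mul_right _ (by omega)
        _ = (q * k) ^ 5 := by ring
    calc (m + k + 1) ^ (6 * k) ≤ ((q * k) ^ 5) ^ (6 * k) := Nat.pow_le_pow_left h1 _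
      _ = (q * k) ^ (30 * k) := by rw [← pow_mul]; congr 1; ring
      _ ≤ 46656 * (q * k) ^ (30 * k) := Nat.le_mul_of_pos_left _ (by norm_num)

theorem ends_search {k q : ℕ} (hk : 1 ≤ k) (hq : 1 ≤ q) (hkn : k ≤ I.n) :
    Ends (.seq (.kernel 8) (.seq .collect (.seq .prepare
        (.seq (.loop (.sub (.lit 1) (.add (.reg 24) (.reg 25))) .step)
          (.assign 0 (.reg 25)))))) (I.input k q)
      (20000 * 46656 * (q * k) ^ (30 * k) * (I.n + 1) ^ 3) fun s =>
        (s.reg 0 ≠ 0 → I.OutputsSolution k s) ∧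
        (s.reg 0 = 0 → ¬ I.HasSolution Finset.univ k I.N ((1 - 1 / (q : ℝ)) * I.N)) := by
  have hl := I.loaded_input k q
  have hz : ∀ A p, 2 ≤ A → (I.input k q).arr A p = 0 := fun A p hA => by
    simp only [input]
    split_ifs <;> omega
  set m := (I.kernelSet k q).card with hm
  have hmq : m ≤ 4 * (q * k ^ 2) := I.card_kernelSet_le hq
  have hn : 0 < I.n := by omega
  refine (Ends.seq (I.ends_kernel hl (.inl le_rfl) fun i => hz 8 i (by omega)) fun s₁ hf₁ h₁ =>
    Ends.seq (T₁ := 100 * (I.n + 1)) (Q₁ := fun s' => s'.reg 10 = m ∧ ∃ L : ℕ → Fin I.n,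
      (∀ p, s'.arr 9 p = L p) ∧ ∀ i ∈ I.kernelSet k q, ∃ p < m, L p = i)
      ?_ fun s₂ hf₂ ⟨h10, L, hL, hLm⟩ =>
    Ends.seq (T₁ := 100) (Q₁ := I.Searching k q m L 0) ?_ fun s₃ hf₃ h₃ =>
    Ends.seq (Q₁ := fun s' => ∃ i, I.Searching k q m L i s' ∧ (s'.reg 24 = 0 → s'.reg 25 ≠ 0))
      (Ends.loop (T := 2000 * ((k + 2) * (k + 2))) (m := (m + k + 1) ^ (6 * k))
        (I.Searching k q m L) (fun i s' hs h => ?_) (fun i s' hs h => ?_) h₃)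
      fun s₄ hf₄ ⟨i, h₄, hex⟩ => Ends.straight (p := .assign 0 _) rfl ?_).mono ?_ fun _ _ h => h
  · have l₁ := hl.frame hf₁ (by decide) (by decide)
    have z₁ : ∀ p, s₁.arr 9 p = 0 := fun p => by
      rw [hf₁.arr 9 (by decide)]
      exact hz 9 p (by omega)
    refine (ends_collect z₁).mono (by rw [l₁.reg3]) fun s' _ ⟨c1, c2, c3⟩ => ?_
    rw [l₁.reg3] at c1 c2 c3
    have hlt : ∀ p, s'.arr 9 p < I.n := fun p => by have := c2 p; omega
    have h10 : s'.reg 10 = m := by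
      rw [c3, Finset.sum_range, hm]
      simp only [h₁]
      simp
    refine ⟨h10, fun p => ⟨_, hlt p⟩, fun p => rfl, fun i hi => ?_⟩
    obtain ⟨p, hp, hpi⟩ := c1 i i.2 ((h₁ i).2 hi)
    exact ⟨p, by omega, Fin.ext hpi⟩
  · have l₁ := hl.frame hf₁ (by decide) (by decide)
    have l₂ := l₁.frame hf₂ (by decide) (by decide)
    refine (Ends.straight (p := .prepare) rfl (Q := fun s' => s'.reg 11 = m + k + 1 ∧
      s'.reg 12 = k ∧ s'.reg 13 = 2 * k ∧ s'.reg 14 = 3 * k ∧ s'.reg 15 = 4 * k ∧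
      s'.reg 16 = 5 * k ∧ s'.reg 17 = 6 * k ∧ s'.reg 24 = 0 ∧ s'.reg 25 = 0) ?_).mono
      (by simp [Program.prepare, Program.size, Expr.cost])
      fun s₃ hf₃ ⟨r11, r12, r13, r14, r15, r16, r17, r24, r25⟩ => ?_
    · simp [Program.prepare, Program.exec, Expr.eval, h10, l₂.reg0]
      omega
    · have l₃ := l₂.frame hf₃ (by decide) (by decide)
      refine ⟨⟨l₃, fun p => ?_, r11, r12, r13, r14, r15, r16, r17⟩,
        .inr ⟨r25, fun p => ?_, fun j hj => absurd hj (Nat.not_lt_zero j),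
          .inl ⟨r24, Nat.pos_of_ne_zero (by positivity), fun p _ => ?_⟩⟩⟩
      · rw [hf₃.arr 9 (by decide)]
        exact hL p
      · rw [hf₃.arr 2 (by decide), hf₂.arr 2 (by decide), hf₁.arr 2 (by decide)]
        exact hz 2 p (by omega)
      · rw [hf₃.arr 10 (by decide), hf₂.arr 10 (by decide), hf₁.arr 10 (by decide),
          hz 10 p (by omega)]
        simp
  · simp only [Expr.eval] at h
    have h24 : s'.reg 24 = 0 := by omega
    have h25 : s'.reg 25 = 0 := by omega
    refine ⟨?_, ends_step hs h24 h25⟩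
    rcases hs.state with ⟨e, -⟩ | ⟨-, -, -, ⟨-, hi, -⟩ | ⟨e, -⟩⟩
    · omega
    · exact hi
    · omega
  · simp only [Expr.eval] at h
    exact ⟨i, hs, fun _ => by omega⟩
  · have hexec : (Program.exec (.assign 0 (.reg 25)) s₄).reg 0 = s₄.reg 25 := by
      simp [Program.exec, Expr.eval]
    rw [hexec]
    rcases h₄.state with ⟨e, ho⟩ | ⟨e, -, hno, ⟨h24, -⟩ | ⟨-, rfl⟩⟩
    · exact ⟨fun _ => ho.congr rfl rfl rfl rfl, fun h => by omega⟩
    · exact (hex h24 e).elim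
    · refine ⟨fun h => absurd e h, fun _ hsol => ?_⟩
      obtain ⟨j, hj, hE⟩ := (hsol.kernelSet hq).encodes hLm
      exact hno j hj hE
  · set E := (m + k + 1) ^ (6 * k) with hE
    have hEle : E ≤ 46656 * (q * k) ^ (30 * k) := base_pow_le hk hq hmq
    have hE1 : 1 ≤ E := Nat.one_le_pow _ _ (by omega)
    have hk2 : (k + 2) * (k + 2) ≤ 4 * (I.n + 1) ^ 2 := by nlinarith
    have hn1 : (I.n + 1) ^ 2 ≤ (I.n + 1) ^ 3 := Nat.pow_le_pow_right (by omega) (by norm_num)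
    have hn2 : I.n + 1 ≤ (I.n + 1) ^ 3 := Nat.le_self_pow (by norm_num) _
    have hn3 : 1 ≤ (I.n + 1) ^ 3 := Nat.one_le_pow _ _ (by omega)
    simp only [Expr.cost, Program.size]
    calc _ ≤ 20000 * (E * (I.n + 1) ^ 3) := by
          set c := (I.n + 1) ^ 3
          have h1 : (E + 1) * (2000 * ((k + 2) * (k + 2)) + (1 + (1 + 1 + 1) + 1) + 1)
              ≤ (E + E) * (8000 * c + 6 * c) := Nat.mul_le_mul (by omega) (by omega)
          have h2 : c ≤ E * c := Nat.le_mul_of_pos_left _ hE1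
          nlinarith
      _ ≤ 20000 * (46656 * (q * k) ^ (30 * k) * (I.n + 1) ^ 3) := by gcongr
      _ = _ := by ring

theorem exists_search_program : ∃ (P : Program) (C : ℕ), ∀ (k q : ℕ), 1 ≤ q →
    ∀ I : KnapsackInstance, ∃ (t : ℕ) (s : State), Runs P (I.input k q) t s ∧
      t ≤ C * (q * k) ^ (C * k) * (I.n + 1) ^ C ∧
      (s.reg 0 ≠ 0 → I.OutputsSolution k s) ∧
      (s.reg 0 = 0 →
        ¬ I.HasSolution Finset.univ k (I.N : ℝ) ((1 - 1 / (q : ℝ)) * (I.N : ℝ))) := by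
  obtain ⟨C, hC⟩ : ∃ C, C = 20001 * 46656 := ⟨_, rfl⟩
  refine ⟨.search, C, fun k q hq I => ?_⟩
  have hl := I.loaded_input k q
  have hn : 1 ≤ (I.n + 1) ^ C := Nat.one_le_pow _ _ (by omega)
  suffices Ends .search (I.input k q) (C * (q * k) ^ (C * k) * (I.n + 1) ^ C) fun s =>
      (s.reg 0 ≠ 0 → I.OutputsSolution k s) ∧
      (s.reg 0 = 0 → ¬ I.HasSolution Finset.univ k I.N ((1 - 1 / (q : ℝ)) * I.N)) by
    obtain ⟨t, s, hr, ht, h⟩ := this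
    exact ⟨t, s, hr, ht, h⟩
  rcases Nat.eq_zero_or_pos k with rfl | hk
  · refine (Ends.branch (e := .reg 0) (T := 2) (fun h => absurd hl.reg0 h) fun _ =>
      Ends.straight (p := .assign 0 (.lit 1)) rfl ?_).mono ?_ fun _ _ h => h
    · have hout : I.outSet (Program.exec (.assign 0 (.lit 1)) (I.input 0 q)) = ∅ := by
        ext i
        simp [outSet, Program.exec, input]
      refine ⟨fun _ => ⟨by rw [hout]; rfl, ?_⟩, fun h => ?_⟩
      · rw [hout]
        simp [IsPacking]
      · simp [Program.exec, Expr.eval] at h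
    · simp only [Expr.cost, mul_zero, pow_zero, mul_one]
      nlinarith
  have hqk : 1 ≤ q * k := Nat.mul_pos hq hk
  have hE : 1 ≤ (q * k) ^ (30 * k) := Nat.one_le_pow _ _ hqk
  have hn3 : 1 ≤ (I.n + 1) ^ 3 := Nat.one_le_pow _ _ (by omega)
  have hEn : 1 ≤ (q * k) ^ (30 * k) * (I.n + 1) ^ 3 := Nat.mul_pos hE hn3
  refine (Ends.branch (e := .reg 0)
    (T := 20000 * 46656 * (q * k) ^ (30 * k) * (I.n + 1) ^ 3 + 6) (fun _ =>
    (Ends.branch (e := .ifLe (.reg 0) (.reg 3)) (fun h => ends_search hk hq ?_)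
      fun h => ?_).mono (by simp only [Expr.ifLe, Expr.cost]; omega) fun _ _ h => h)
    fun h => absurd (hl.reg0.symm.trans h) (by omega)).mono ?_ fun _ _ h => h
  · simpa [Expr.eval, hl.reg0, hl.reg3] using h
  · refine (Ends.straight (p := .assign 0 (.lit 0)) rfl ?_).mono ?_ fun _ _ h => h
    · refine ⟨fun h => by simp [Program.exec, Expr.eval] at h, fun _ hsol => ?_⟩
      have := hsol.le_n
      simp [Expr.eval, hl.reg0, hl.reg3] at h
      omega
    · simp only [Program.size, Expr.cost]
      nlinarith
  · calc _ ≤ C * ((q * k) ^ (30 * k) * (I.n + 1) ^ 3) := by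
          simp only [Expr.cost]
          rw [hC]
          nlinarith
      _ ≤ C * ((q * k) ^ (C * k) * (I.n + 1) ^ C) := by
          have h1 : 30 ≤ C := by omega
          have h2 : 3 ≤ C := by omega
          gcongr
          omega
      _ = _ := by ring

end KnapsackInstance

theorem mainTheorem7 :
    (∃ (P : RAM.Program) (C : ℕ), ∀ (k q : ℕ), 1 ≤ q → ∀ I : KnapsackInstance,
      ∃ (t : ℕ) (s : RAM.State), RAM.Runs P (I.input k q) t s ∧
        t ≤ C * (q * k) ^ (C * k) * (I.n + 1) ^ C ∧
        (s.reg 0 ≠ 0 → I.OutputsSolution k s) ∧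
        (s.reg 0 = 0 →
          ¬ I.HasSolution Finset.univ k (I.N : ℝ) ((1 - 1 / (q : ℝ)) * (I.N : ℝ)))) ∧
    (∃ (P : RAM.Program) (C : ℕ), ∀ (k q : ℕ), 1 ≤ q → ∀ I : KnapsackInstance,
      ∃ (t : ℕ) (s : RAM.State), RAM.Runs P (I.input k q) t s ∧
        t ≤ C * (I.n + 1) ^ C ∧
        (I.outSet s).card ≤ C * (q * k ^ 2) ∧
        (I.HasSolution Finset.univ k (I.N : ℝ) ((1 - 1 / (q : ℝ)) * (I.N : ℝ)) →
          I.HasSolution (I.outSet s) k (I.N : ℝ) (I.N : ℝ))) :=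
  ⟨KnapsackInstance.exists_search_program, KnapsackInstance.exists_kernel_program⟩
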